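/- Let $A$ be a finite set, and let $\mathcal A$ and $\mathcal B$ be two structures with domain $A$, each over its own finite signature of operation symbols and relation symbols. Suppose that 1. $\mathcal A$ and $\mathcal B$ have the same term operations $A^n \to A$ for all $n \ge 1$; that is, the basic operations of (the algebraic reduct of) $\mathcal A$ and those of $\mathcal B$ generate the same clone on $A$; and 2. the relational reducts of $\mathcal A$ and $\mathcal B$ have the same partial polymorphisms. Here a partial operation $h\colon A^n \rightharpoonup A$, $n \ge 1$, is a partial polymorphism of a relational structure if for every relation $R$ of the structure and all tuples $t_1,\dots,t_n\in R$, whenever $h(t_1,\dots,t_n)$, computed componentwise, is defined, it belongs to $R$. Then $\mathrm{CSP}(\mathcal A)$ and $\mathrm{CSP}(\mathcal B)$ are equivalent under polynomial-time many-one reductions. Here, for a structure $\mathcal A$ with signature $S$, $\mathrm{CSP}(\mathcal A)$ is the problem of deciding whether a given finite $S$-structure $\mathcal X$ admits a homomorphism to $\mathcal A$, viewed as a set of binary words: it consists of the encodings of those $\mathcal X$ that admit such a homomorphism, where a structure with domain $\{0,\dots,m-1\}$ is encoded by $m$ in unary followed by the characteristic bit strings of the graphs of its basic operations and of its basic relations.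 -/

import Mathlib

open FirstOrder

universe u v u' v' w

namespace FinCSP

/-! A signature is a first-order language `L`, its symbols coming with arities; `S`-structures and
homomorphisms are `L.Structure` and `M →[L] N`, terms over `x_1, …, x_n` are `L.Term (Fin n)`. -/

section Invariants

variable (L : FirstOrder.Language.{u, v}) (A : Type w) [L.Structure A]

/-- The clone generated by the basic operations of `A`: the term operations `A ^ n → A`, `n ≥ 1`.
Terms contain function symbols only, so this depends only on the algebraic reduct of `A`. -/
def clone : Set (Σ n : ℕ, (Fin n → A) → A) :=
  {g | 0 < g.1 ∧ ∃ t : L.Term (Fin g.1), ∀ x : Fin g.1 → A, t.realize x = g.2 x}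

/-- The partial operation `h` preserves the `k`-ary relation `R`: for all tuples `t_1, …, t_n` in
`R`, if `h (t_1, …, t_n)`, computed componentwise, is defined (in every component) and equals `s`,
then `s` is in `R`. -/
def PartialPreserves {A : Type w} {n k : ℕ} (h : (Fin n → A) →. A) (R : (Fin k → A) → Prop) :
    Prop :=
  ∀ t : Fin n → Fin k → A, (∀ i, R (t i)) →
    ∀ s : Fin k → A, (∀ j, s j ∈ h (fun i => t i j)) → R s

/-- The partial polymorphisms (of arities `n ≥ 1`) of the relational reduct of `A`. -/
def partialPolymorphisms : Set (Σ n : ℕ, (Fin n → A) →. A) :=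
  {h | 0 < h.1 ∧ ∀ (k : ℕ) (R : L.Relations k),
    PartialPreserves h.2 (fun x : Fin k → A => FirstOrder.Language.Structure.RelMap R x)}

end Invariants

section Encoding

open Classical in
/-- The characteristic bit string, of length `n ^ k`, of a `k`-ary relation on `{0, …, n - 1}`. -/
noncomputable def encodeRel {n k : ℕ} (R : (Fin k → Fin n) → Prop) : List Bool :=
  List.ofFn fun j : Fin (n ^ k) => decide (R (finFunctionFinEquiv.symm j))

variable (L : FirstOrder.Language.{u, v})
  [Fintype (Σ k, L.Functions k)] [Fintype (Σ k, L.Relations k)]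

/-- The encoding of a finite structure `X` with domain `{0, …, n - 1}`: the number `n` in unary,
then, in a fixed order of the symbols, the characteristic strings of the graphs of the basic
operations and of the basic relations. -/
noncomputable def encode {n : ℕ} (X : L.Structure (Fin n)) : List Bool :=
  List.replicate n true ++ false ::
    ((Finset.univ : Finset (Σ k, L.Functions k)).toList.flatMap (fun f =>
        encodeRel (fun x : Fin (f.1 + 1) → Fin n => X.funMap f.2 (Fin.init x) = x (Fin.last f.1)))
      ++ (Finset.univ : Finset (Σ k, L.Relations k)).toList.flatMap (fun R =>
        encodeRel (fun x : Fin R.1 → Fin n => X.RelMap R.2 x)))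

/-- The decision problem `CSP(A)`, as a set of words: the encodings of the finite structures `X`
that admit a homomorphism to `A`. -/
def CSP (A : Type w) [L.Structure A] : _root_.Language Bool :=
  {word | ∃ (n : ℕ) (X : L.Structure (Fin n)),
    encode L X = word ∧ (letI := X; Nonempty (Fin n →[L] A))}

end Encoding

/-- Polynomial-time many-one (Karp) reducibility of decision problems over `{0, 1}`. -/
def PolyTimeReduces (P Q : _root_.Language Bool) : Prop :=
  ∃ f : List Bool → List Bool,
    Nonempty (Turing.TM2ComputableInPolyTime (fun x : List Bool => x) (fun x : List Bool => x) f) ∧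
    ∀ x, x ∈ P ↔ f x ∈ Q

/-- Equivalence under polynomial-time many-one reductions. -/
def PolyTimeEquivalent (P Q : _root_.Language Bool) : Prop :=
  PolyTimeReduces P Q ∧ PolyTimeReduces Q P

end FinCSP

/-!
Write `A` for the first structure and `A'` for the second, with the same domain. Both hypotheses are
symmetric, so a reduction of `CSP(A)` to `CSP(A')` suffices.

*The algebra.* Equality of the clones makes every basic operation of either structure a term
operation of the other (`FinCSP.exists_term_of_clone_eq`); constants are handled by a dummy last
variable. Equality of the partial polymorphisms makes every nonempty relation `R` of `A` the set of
solutions of the equalities between coordinates and of the atomic formulas of `A'` that hold in all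
tuples of `R` (`FinCSP.relMap_of_partialPolymorphisms_eq`): a further solution would yield a partial
polymorphism of `A'` that does not preserve `R`.

Given an instance `X` of `CSP(A)`, let `E` be the least congruence on `X` that identifies the value
of each operation of `A` with the value of its double translation, makes the translations of the
operations of `A'` independent of their dummy variables, and identifies the coordinates of tuples in
a relation that are equal throughout the corresponding relation of `A` (`FinCSP.closureStep`). Every
homomorphism `X → A` factors through `X / E`. The operations of `A'` act on `X / E` by their
translations, and the relations of `A'` are those forced by the relations of `X`. With this
structure, `X / E` has a homomorphism to `A'` if and only if `X` has one to `A`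
(`FinCSP.nonempty_hom_iff`). Instead of passing to the quotient, the output keeps the domain of `X`
and lets the operations take the least representatives of classes as values
(`FinCSP.quotientStructure`), so that the elements need not be renumbered.

*The complexity.* Polynomial time means computation by a `TM2` machine. Programs are written in a
language of while programs on stacks of bits, with a big-step semantics that counts steps and a
compilation to `TM2` machines (`StackProgram.Runs.steps`, `StackProgram.computableInPolyTime`). The
relations of `X` and the congruence are tables kept on stacks. Properties of tuples that are
definable by first-order formulas over the tables can be tested in polynomial time
(`StackProgram.PolyTest` and its closure properties); hence so can their characteristic strings be
written (`StackProgram.PolyTest.emit`), and recursive definitions be iterated polynomially often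
(`StackProgram.PolyTest.iterate`). One round of the generation of `E`, the output, and the validity
of the input are first-order in this sense, and `n ^ 2` rounds suffice for a domain of `n` elements,
since a growing set of pairs becomes stationary by then (`FinCSP.iterate_fixed_of_card_le`).

Words that encode no structure, and structures with a nonempty relation whose counterpart in `A` is
empty, are sent to the empty word, which encodes nothing. The remaining structures with empty domain
are yes-instances, and are sent to the encoding of a copy of `A'`.
-/

/-! ### A structured language of stack programs and its compilation to `TM2` machines -/

namespace StackProgram

/-- The finite memory of a stack program: a flag, and the result of the last pop. -/
abbrev Reg := Bool × Option Bool

/-- Structured programs acting on a family of stacks of bits indexed by `K`: `push k f` pushes the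
bit `f r`, where `r` is the content of the memory; `pop k f` updates the memory by the bit popped, or by
`none` if the stack is empty; `load f` updates the memory by `f`; `ite` and `loop` are branches and
while loops whose conditions depend on the memory alone. -/
inductive Prog (K : Type u) : Type u
  | push (k : K) (f : Reg → Bool) : Prog K
  | pop (k : K) (f : Reg → Option Bool → Reg) : Prog K
  | load (f : Reg → Reg) : Prog K
  | seq (p q : Prog K) : Prog K
  | ite (c : Reg → Bool) (p q : Prog K) : Prog K
  | loop (c : Reg → Bool) (p : Prog K) : Prog K

section Semantics

variable {K : Type u} [DecidableEq K]

/-- Big-step semantics: `Runs p a b t` says that `p`, started in the memory and stacks `a`, ends in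
`b` after exactly `t` steps. -/
inductive Runs : Prog K → Reg × (K → List Bool) → Reg × (K → List Bool) → ℕ → Prop
  | push (k f r S) : Runs (.push k f) (r, S) (r, Function.update S k (f r :: S k)) 1
  | pop (k f r S) :
      Runs (.pop k f) (r, S) (f r (S k).head?, Function.update S k (S k).tail) 1
  | load (f r S) : Runs (.load f) (r, S) (f r, S) 1
  | seq {p q a b c t u} : Runs p a b t → Runs q b c u → Runs (.seq p q) a c (t + u)
  | ite_true {c p q a b t} : c a.1 = true → Runs p a b t → Runs (.ite c p q) a b (t + 1)
  | ite_false {c p q a b t} : c a.1 = false → Runs q a b t → Runs (.ite c p q) a b (t + 1)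
  | loop_false {c p a} : c a.1 = false → Runs (.loop c p) a a 1
  | loop_true {c p a b d t u} : c a.1 = true → Runs p a b t → Runs (.loop c p) b d u →
      Runs (.loop c p) a d (t + u + 1)

end Semantics

namespace Prog

variable {K : Type u}

/-- The control points of a program. -/
def Lab : Prog K → Type
  | push _ _ => Unit
  | pop _ _ => Unit
  | load _ => Unit
  | seq p q => p.Lab ⊕ q.Lab
  | ite _ p q => Option (p.Lab ⊕ q.Lab)
  | loop _ p => Option p.Lab

instance lab_finite : (p : Prog K) → Finite p.Lab
  | push _ _ => inferInstanceAs (Finite Unit)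
  | pop _ _ => inferInstanceAs (Finite Unit)
  | load _ => inferInstanceAs (Finite Unit)
  | seq p q =>
      have := p.lab_finite
      have := q.lab_finite
      inferInstanceAs (Finite (p.Lab ⊕ q.Lab))
  | ite _ p q =>
      have := p.lab_finite
      have := q.lab_finite
      inferInstanceAs (Finite (Option (p.Lab ⊕ q.Lab)))
  | loop _ p =>
      have := p.lab_finite
      inferInstanceAs (Finite (Option p.Lab))

/-- The control point at which a program starts. -/
def entry : (p : Prog K) → p.Lab
  | push _ _ => ()
  | pop _ _ => ()
  | load _ => ()
  | seq p _ => Sum.inl p.entry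
  | ite _ _ _ => none
  | loop _ _ => none

/-- The stacks that a program mentions. -/
def supp [DecidableEq K] : Prog K → Finset K
  | push k _ => {k}
  | pop k _ => {k}
  | load _ => ∅
  | seq p q => p.supp ∪ q.supp
  | ite _ p q => p.supp ∪ q.supp
  | loop _ p => p.supp

open Classical in
/-- The machine code of a program, as part of a machine with labels `Λ` and stacks `K'`. The stack
`i` of the machine is the stack `e i` of the program, `emb` embeds the control points into the
labels, and control passes to `exit` at the end. -/
noncomputable def code {K' Λ : Type} (e : K' → K) :
    (p : Prog K) → (p.Lab → Λ) → Λ → p.Lab → Turing.TM2.Stmt (fun _ : K' => Bool) Λ Reg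
  | push k f, _, exit, _ =>
      if h : ∃ i, e i = k then .push h.choose f (.goto fun _ => exit) else .halt
  | pop k f, _, exit, _ =>
      if h : ∃ i, e i = k then .pop h.choose f (.goto fun _ => exit) else .halt
  | load f, _, exit, _ => .load f (.goto fun _ => exit)
  | seq p q, emb, _, Sum.inl l =>
      p.code e (fun l => emb (Sum.inl l)) (emb (Sum.inr q.entry)) l
  | seq _ q, emb, exit, Sum.inr l => q.code e (fun l => emb (Sum.inr l)) exit l
  | ite c p q, emb, _, none =>
      .branch c (.goto fun _ => emb (some (Sum.inl p.entry)))
        (.goto fun _ => emb (some (Sum.inr q.entry)))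
  | ite _ p _, emb, exit, some (Sum.inl l) => p.code e (fun l => emb (some (Sum.inl l))) exit l
  | ite _ _ q, emb, exit, some (Sum.inr l) => q.code e (fun l => emb (some (Sum.inr l))) exit l
  | loop c p, emb, exit, none =>
      .branch c (.goto fun _ => emb (some p.entry)) (.goto fun _ => exit)
  | loop _ p, emb, _, some l => p.code e (fun l => emb (some l)) (emb none) l

end Prog

section Simulation

variable {K : Type u} [DecidableEq K] {K' Λ : Type} [DecidableEq K']

/-- `t` steps of the machine `M` lead from `a` to `b`. -/
def Steps (M : Λ → Turing.TM2.Stmt (fun _ : K' => Bool) Λ Reg)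
    (a b : Turing.TM2.Cfg (fun _ : K' => Bool) Λ Reg) (t : ℕ) : Prop :=
  (flip bind (Turing.TM2.step M))^[t] (some a) = some b

theorem Steps.trans {M : Λ → Turing.TM2.Stmt (fun _ : K' => Bool) Λ Reg}
    {a b c : Turing.TM2.Cfg (fun _ : K' => Bool) Λ Reg} {t u : ℕ}
    (h : Steps M a b t) (h' : Steps M b c u) : Steps M a c (t + u) := by
  unfold Steps at *
  rw [add_comm, Function.iterate_add_apply, h, h']

theorem Steps.one {M : Λ → Turing.TM2.Stmt (fun _ : K' => Bool) Λ Reg}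
    {a b : Turing.TM2.Cfg (fun _ : K' => Bool) Λ Reg} (h : Turing.TM2.step M a = some b) :
    Steps M a b 1 := by
  simpa [Steps, flip] using h

/-- The machine code of a program simulates it step by step. -/
theorem Runs.steps {e : K' → K} (he : Function.Injective e)
    {p : Prog K} {a b : Reg × (K → List Bool)} {t : ℕ} (h : Runs p a b t)
    (hsupp : ∀ k ∈ p.supp, ∃ i, e i = k)
    {M : Λ → Turing.TM2.Stmt (fun _ : K' => Bool) Λ Reg} {emb : p.Lab → Λ} {exit : Λ}
    (hM : ∀ l, M (emb l) = p.code e emb exit l) :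
    Steps M ⟨some (emb p.entry), a.1, a.2 ∘ e⟩ ⟨some exit, b.1, b.2 ∘ e⟩ t := by
  induction h generalizing exit with
  | push k f r S =>
    have hk : ∃ i, e i = k := hsupp k (by simp [Prog.supp])
    have hc := hk.choose_spec
    apply Steps.one
    rw [Turing.TM2.step, hM]
    simp only [Prog.code, dif_pos hk, Turing.TM2.stepAux]
    congr 2
    conv_rhs => rw [← hc, Function.update_comp_eq_of_injective _ he]
    simp
  | pop k f r S =>
    have hk : ∃ i, e i = k := hsupp k (by simp [Prog.supp])
    have hc := hk.choose_spec
    apply Steps.one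
    rw [Turing.TM2.step, hM]
    simp only [Prog.code, dif_pos hk, Turing.TM2.stepAux]
    congr 2
    · simp [hc]
    · conv_rhs => rw [← hc, Function.update_comp_eq_of_injective _ he]
      simp
  | load f r S =>
    apply Steps.one
    rw [Turing.TM2.step, hM]
    simp only [Prog.code, Turing.TM2.stepAux]
  | seq _ _ ih₁ ih₂ =>
    exact (ih₁ (fun k hk => hsupp k (by simp [Prog.supp, hk])) (fun l => hM (Sum.inl l))).trans
      (ih₂ (fun k hk => hsupp k (by simp [Prog.supp, hk])) (fun l => hM (Sum.inr l)))
  | @ite_true c p q a b t hc _ ih =>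
    rw [add_comm]
    refine (Steps.one ?_).trans (ih (fun k hk => hsupp k (by simp [Prog.supp, hk]))
      (fun l => hM (some (Sum.inl l))))
    rw [Turing.TM2.step, hM]
    simp [Prog.entry, Prog.code, Turing.TM2.stepAux, hc]
  | @ite_false c p q a b t hc _ ih =>
    rw [add_comm]
    refine (Steps.one ?_).trans (ih (fun k hk => hsupp k (by simp [Prog.supp, hk]))
      (fun l => hM (some (Sum.inr l))))
    rw [Turing.TM2.step, hM]
    simp [Prog.entry, Prog.code, Turing.TM2.stepAux, hc]
  | loop_false hc =>
    apply Steps.one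
    rw [Turing.TM2.step, hM]
    simp [Prog.entry, Prog.code, Turing.TM2.stepAux, hc]
  | @loop_true c p a b d t u hc _ _ ih₁ ih₂ =>
    rw [add_comm, ← add_assoc, add_assoc 1 t u, ← add_assoc]
    refine ((Steps.one ?_).trans (ih₁ (emb := fun l => emb (some l))
      (fun k hk => hsupp k (by simpa [Prog.supp] using hk))
      (fun l => hM (some l)))).trans (ih₂ hsupp hM)
    rw [Turing.TM2.step, hM]
    simp [Prog.entry, Prog.code, Turing.TM2.stepAux, hc]

end Simulation

/-- The stacks that are all empty except for `k`, which holds `l`. -/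
def single {K : Type u} [DecidableEq K] (k : K) (l : List Bool) : K → List Bool :=
  Function.update (fun _ => []) k l

/-- A function computed by a stack program in polynomial time is computed by a `TM2` machine in
polynomial time. The program has to leave all its stacks but the output stack empty. -/
theorem computableInPolyTime {K : Type u} [DecidableEq K] (p : Prog K) (kin kout : K)
    (f : List Bool → List Bool) (T : Polynomial ℕ)
    (h : ∀ x, ∃ t ≤ T.eval x.length,
      Runs p ((false, none), single kin x) ((false, none), single kout (f x)) t) :
    Nonempty (Turing.TM2ComputableInPolyTime (fun x : List Bool => x) (fun x : List Bool => x)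
      f) := by
  classical
  let A : Finset K := p.supp ∪ {kin, kout}
  let E : Fin A.card ≃ A := A.equivFin.symm
  let e : Fin A.card → K := fun i => (E i : K)
  have he : Function.Injective e := Subtype.val_injective.comp E.injective
  have hA : ∀ k ∈ A, ∃ i, e i = k := fun k hk => ⟨E.symm ⟨k, hk⟩, by simp [e]⟩
  obtain ⟨i₀, hi₀⟩ := hA kin (by simp [A])
  obtain ⟨i₁, hi₁⟩ := hA kout (by simp [A])
  let M : Option p.Lab → Turing.TM2.Stmt (fun _ : Fin A.card => Bool) (Option p.Lab) Reg
    | none => .halt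
    | some l => p.code e some none l
  have hsingle : ∀ (k : K) (i : Fin A.card) (_ : e i = k) (l : List Bool),
      single k l ∘ e = fun j => if j = i then l else [] := by
    intro k i hi l
    funext j
    by_cases hj : j = i
    · subst hj; simp [single, hi]
    · have : e j ≠ k := fun h' => hj (he (h'.trans hi.symm))
      simp [single, hj, this]
  let _ := Fintype.ofFinite p.Lab
  let tm : Turing.FinTM2 :=
    { K := Fin A.card, k₀ := i₀, k₁ := i₁, Γ := fun _ => Bool, Λ := Option p.Lab,
      main := some p.entry, σ := Reg, initialState := (false, none), Γk₀Fin := inferInstance,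
      m := M }
  refine ⟨{ tm := tm, inputAlphabet := Equiv.refl _, outputAlphabet := Equiv.refl _,
            time := T + 1, outputsFun := fun x => ?_ }⟩
  obtain ⟨t, ht, hr⟩ := Classical.indefiniteDescription _ (h x)
  have hs := hr.steps (M := M) (emb := some) (exit := none) he
    (fun k hk => hA k (by simp [A, hk])) (fun _ => rfl)
  have hs' := hs.trans (Steps.one (M := M) (b := ⟨none, (false, none), single kout (f x) ∘ e⟩) rfl)
  refine ⟨⟨t + 1, ?_⟩, by simpa using ht⟩
  have h₀ : Turing.initList tm (List.map (Equiv.refl _).invFun x) =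
      ⟨some (some p.entry), (false, none), single kin x ∘ e⟩ := by
    rw [hsingle _ _ hi₀]
    simp only [Turing.initList]
    congr 1
    funext k
    by_cases hk : k = i₀
    · simp [tm, hk]
    · simp [tm, hk]
  have h₁ : Turing.haltList tm (List.map (Equiv.refl _).invFun (f x)) =
      ⟨none, (false, none), single kout (f x) ∘ e⟩ := by
    rw [hsingle _ _ hi₁]
    simp only [Turing.haltList]
    congr 1
    funext k
    by_cases hk : k = i₁
    · simp [tm, hk]
    · simp [tm, hk]
  have h₂ : (flip bind tm.step)^[t + 1]
      (some (Turing.initList tm (List.map (Equiv.refl _).invFun x))) =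
      some (Turing.haltList tm (List.map (Equiv.refl _).invFun (f x))) := by
    rw [h₀, h₁]
    exact hs'
  exact h₂

end StackProgram

/-! ### Basic stack programs and their running times -/

namespace StackProgram

section Basic

variable {K : Type u} [DecidableEq K]

/-- Started with flag `b`, last popped bit `o` and stacks `S`, the program `p` ends with flag `b'`
and stacks `S'` within `T` steps. -/
def DoesAt (p : Prog K) (o : Option Bool) (b : Bool) (S : K → List Bool) (b' : Bool)
    (S' : K → List Bool) (T : ℕ) : Prop :=
  ∃ o', ∃ t ≤ T, Runs p ((b, o), S) ((b', o'), S') t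

/-- Started with flag `b` and stacks `S`, the program `p` ends with flag `b'` and stacks `S'` within
`T` steps, whatever bit was popped last. -/
def Does (p : Prog K) (b : Bool) (S : K → List Bool) (b' : Bool) (S' : K → List Bool) (T : ℕ) :
    Prop :=
  ∀ o, DoesAt p o b S b' S' T

variable {p q : Prog K} {b b' b'' : Bool} {o : Option Bool} {S S' S'' : K → List Bool} {T T' : ℕ}

theorem DoesAt.mono (h : DoesAt p o b S b' S' T) (hT : T ≤ T') : DoesAt p o b S b' S' T' := by
  obtain ⟨o', t, ht, hr⟩ := h
  exact ⟨o', t, ht.trans hT, hr⟩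

theorem Does.mono (h : Does p b S b' S' T) (hT : T ≤ T') : Does p b S b' S' T' :=
  fun o => (h o).mono hT

theorem Does.of (h : Does p b S b' S' T) (hb : b' = b'') (hS : S' = S'') (hT : T ≤ T') :
    Does p b S b'' S'' T' := by
  subst hb hS
  exact h.mono hT

theorem DoesAt.of (h : DoesAt p o b S b' S' T) (hb : b' = b'') (hS : S' = S'') (hT : T ≤ T') :
    DoesAt p o b S b'' S'' T' := by
  subst hb hS
  exact h.mono hT

theorem DoesAt.seq (h : DoesAt p o b S b' S' T) (h' : Does q b' S' b'' S'' T') :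
    DoesAt (.seq p q) o b S b'' S'' (T + T') := by
  obtain ⟨o', t, ht, hr⟩ := h
  obtain ⟨o'', t', ht', hr'⟩ := h' o'
  exact ⟨o'', t + t', by omega, hr.seq hr'⟩

theorem Does.seq (h : Does p b S b' S' T) (h' : Does q b' S' b'' S'' T') :
    Does (.seq p q) b S b'' S'' (T + T') :=
  fun o => (h o).seq h'

/-- Replaces the flag by its image under `f`. -/
def setFlag (f : Bool → Bool) : Prog K := .load fun r => (f r.1, r.2)

theorem does_setFlag (f : Bool → Bool) : Does (setFlag f) b S (f b) S 1 :=
  fun o => ⟨o, 1, le_rfl, .load _ _ _⟩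

/-- The program that does nothing. -/
def skip : Prog K := setFlag id

theorem does_skip : Does skip b S b S 1 := does_setFlag id

/-- Pushes the bit `x` on the stack `k`. -/
def pushBit (k : K) (x : Bool) : Prog K := .push k fun _ => x

theorem does_pushBit (k : K) (x : Bool) :
    Does (pushBit k x) b S b (Function.update S k (x :: S k)) 1 :=
  fun o => ⟨o, 1, le_rfl, .push _ _ _ _⟩

/-- Branches on the flag. -/
def ifFlag (p q : Prog K) : Prog K := .ite (fun r => r.1) p q

theorem does_ifFlag_true (h : Does p true S b' S' T) : Does (ifFlag p q) true S b' S' (T + 1) :=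
  fun o => by
    obtain ⟨o', t, ht, hr⟩ := h o
    exact ⟨o', t + 1, by omega, .ite_true rfl hr⟩

theorem does_ifFlag_false (h : Does q false S b' S' T) :
    Does (ifFlag p q) false S b' S' (T + 1) :=
  fun o => by
    obtain ⟨o', t, ht, hr⟩ := h o
    exact ⟨o', t + 1, by omega, .ite_false rfl hr⟩

/-- Pops the stack `k`, leaving the flag alone. -/
def popBit (k : K) : Prog K := .pop k fun r x => (r.1, x)

theorem runs_popBit (k : K) :
    Runs (popBit k) ((b, o), S) ((b, (S k).head?), Function.update S k (S k).tail) 1 :=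
  .pop k _ _ _

/-- Branches on whether the last pop found the stack nonempty. -/
def ifPopped (p q : Prog K) : Prog K := .ite (fun r => r.2.isSome) p q

theorem doesAt_ifPopped_some {x : Bool} (h : DoesAt p (some x) b S b' S' T) :
    DoesAt (ifPopped p q) (some x) b S b' S' (T + 1) := by
  obtain ⟨o', t, ht, hr⟩ := h
  exact ⟨o', t + 1, by omega, .ite_true rfl hr⟩

theorem doesAt_ifPopped_none (h : DoesAt q none b S b' S' T) :
    DoesAt (ifPopped p q) none b S b' S' (T + 1) := by
  obtain ⟨o', t, ht, hr⟩ := h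
  exact ⟨o', t + 1, by omega, .ite_false rfl hr⟩

/-- A pop followed by a program whose run depends on the popped bit. -/
theorem does_popBit_seq {k : K}
    (h : DoesAt p (S k).head? b (Function.update S k (S k).tail) b' S' T) :
    Does (.seq (popBit k) p) b S b' S' (T + 1) := fun o => by
  obtain ⟨o', t, ht, hr⟩ := h
  exact ⟨o', 1 + t, by omega, (runs_popBit k).seq hr⟩

/-- Pushes the bit popped last on the stack `k`. -/
def pushPopped (k : K) : Prog K := .push k fun r => r.2.getD false

theorem doesAt_pushPopped (k : K) (x : Bool) :
    DoesAt (pushPopped k) (some x) b S b (Function.update S k (x :: S k)) 1 :=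
  ⟨some x, 1, le_rfl, .push _ _ _ _⟩

/-- Pops the stack `k` until it is empty, running `p` after each pop. -/
def drain (k : K) (p : Prog K) : Prog K :=
  .seq (popBit k) (.loop (fun r => r.2.isSome) (.seq p (popBit k)))

theorem does_drain_nil {k : K} (h : S k = []) : Does (drain k p) b S b S 2 := fun o => by
  refine ⟨none, 2, le_rfl, ?_⟩
  have h₁ := runs_popBit (b := b) (o := o) (S := S) k
  rw [h] at h₁
  have h₂ : Function.update S k ([] : List Bool).tail = S := by
    rw [List.tail_nil, ← h, Function.update_eq_self]
  rw [h₂] at h₁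
  exact h₁.seq (u := 1) (.loop_false rfl)

theorem does_drain_cons {k : K} {x : Bool} {l : List Bool} (h : S k = x :: l)
    (hp : DoesAt p (some x) b (Function.update S k l) b' S' T)
    (h' : Does (drain k p) b' S' b'' S'' T') :
    Does (drain k p) b S b'' S'' (T + T' + 2) := fun o => by
  obtain ⟨o₁, t₁, ht₁, hr₁⟩ := hp
  obtain ⟨o₂, t₂, ht₂, hr₂⟩ := h' o₁
  have h₁ := runs_popBit (b := b) (o := o) (S := S) k
  rw [h] at h₁
  cases hr₂ with
  | @seq _ _ _ c _ t u hpop hloop =>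
    refine ⟨o₂, 1 + (t₁ + t + u + 1), by omega, h₁.seq ?_⟩
    exact .loop_true rfl (hr₁.seq hpop) hloop

/-- The running time of a loop whose body does not change the stack `k` being drained. The flag and
the stacks after each round are functions `B` and `F` of the remaining contents of `k`. -/
theorem does_drain {k : K} (l : List Bool) (B : List Bool → Bool) (F : List Bool → K → List Bool)
    (hF : ∀ m, F m k = m)
    (hp : ∀ x m, (x :: m) <:+ l →
      DoesAt p (some x) (B (x :: m)) (Function.update (F (x :: m)) k m) (B m) (F m) T) :
    Does (drain k p) (B l) (F l) (B []) (F []) ((T + 2) * l.length + 2) := by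
  induction l with
  | nil => simpa using does_drain_nil (hF [])
  | cons x m ih =>
    have h₁ := ih fun y m' hm' => hp y m' (hm'.trans (List.suffix_cons x m))
    refine (does_drain_cons (hF (x :: m)) (hp x m List.suffix_rfl) h₁).mono ?_
    simp only [List.length_cons]
    ring_nf
    omega

/-- Moves the contents of `k` to `k'`, reversing them. -/
def move (k k' : K) : Prog K := drain k (pushPopped k')

theorem does_move {k k' : K} (hk : k ≠ k') :
    Does (move k k') b S b
      (Function.update (Function.update S k []) k' ((S k).reverse ++ S k'))
      (3 * (S k).length + 2) := by
  rw [move]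
  generalize hl : S k = l
  induction l generalizing S with
  | nil =>
    refine Does.of (does_drain_nil hl) rfl ?_ le_rfl
    simp [show Function.update S k [] = S by rw [← hl]; simp]
  | cons x m ih =>
    have h₁ := doesAt_pushPopped (b := b) (S := Function.update S k m) k' x
    have h₂ := ih (S := Function.update (Function.update S k m) k'
      (x :: Function.update S k m k')) (by simp [hk])
    refine Does.of (does_drain_cons hl h₁ h₂) rfl ?_ ?_
    · funext j
      by_cases h₁ : j = k' <;> by_cases h₂ : j = k <;> simp_all [Function.update_apply]
    · simp only [List.length_cons]; omega

/-- Empties the stack `k`. -/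
def clear (k : K) : Prog K := drain k skip

theorem does_clear (k : K) :
    Does (clear k) b S b (Function.update S k []) (3 * (S k).length + 2) := by
  have := does_drain (k := k) (p := skip) (T := 1) (S k) (fun _ => b)
    (fun m => Function.update S k m) (by simp)
    (fun x m _ => by simpa using does_skip (some x))
  rw [clear]
  simpa using this

/-- Pushes a copy of `k` on `k'`, reversing it; `tmp` is an auxiliary stack. -/
def copy (tmp k k' : K) : Prog K :=
  .seq (drain k (.seq (pushPopped tmp) (.push k' fun r => r.2.getD false))) (move tmp k)

theorem does_copy {tmp k k' : K} (h₁ : k ≠ tmp) (h₂ : k' ≠ tmp) (h₃ : k ≠ k') (ht : S tmp = []) :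
    Does (copy tmp k k') b S b (Function.update S k' ((S k).reverse ++ S k'))
      (7 * (S k).length + 4) := by
  have key : ∀ l S, S k = l →
      Does (drain k (.seq (pushPopped tmp) (.push k' fun r => r.2.getD false))) b S b
        (Function.update (Function.update (Function.update S k []) tmp (l.reverse ++ S tmp)) k'
          (l.reverse ++ S k')) (4 * l.length + 2) := by
    intro l
    induction l with
    | nil =>
      intro S hl
      refine Does.of (does_drain_nil hl) rfl ?_ le_rfl
      simp [show Function.update S k [] = S by rw [← hl]; simp]
    | cons x m ih =>
      intro S hl
      let S₁ := Function.update S k m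
      let S₂ := Function.update S₁ tmp (x :: S₁ tmp)
      let S₃ := Function.update S₂ k' (x :: S₂ k')
      have h : DoesAt (.seq (pushPopped tmp) (.push k' fun r => r.2.getD false)) (some x) b S₁ b
          S₃ 2 := ⟨some x, 2, le_rfl, .seq (t := 1) (u := 1) (.push _ _ _ _) (.push _ _ _ _)⟩
      have h' := ih S₃ (by simp [S₃, S₂, S₁, h₁, h₃])
      refine Does.of (does_drain_cons hl h h') rfl ?_ ?_
      · funext j
        by_cases h₁ : j = k' <;> by_cases h₂ : j = k <;> by_cases h₃ : j = tmp <;>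
          simp_all [Function.update_apply, S₁, S₂, S₃]
      · simp only [List.length_cons]; omega
  refine Does.of ((key _ S rfl).seq (does_move h₁.symm)) rfl ?_ ?_
  · have h₄ := h₂.symm
    funext j
    by_cases h₁ : j = k' <;> by_cases h₂ : j = k <;> by_cases h₃ : j = tmp <;>
      simp_all
  · simp [h₂.symm, ht]; omega

end Basic

/-- The unary notation of a number. -/
abbrev un (m : ℕ) : List Bool := List.replicate m true

/-- The stacks of the programs below: the input and the output; the size `n` of the structure, in
unary; auxiliary stacks; counters holding in unary the values of the variables, which are numbered;
and the tables of relations on `{0, …, n - 1}`, named by elements of `Arr`. -/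
inductive Stk (Arr : Type u) : Type u
  | inp | out | size | addr | iter | new | tmp | aux
  | ctr (i : ℕ)
  | arr (a : Arr)

noncomputable instance (Arr : Type u) : DecidableEq (Stk Arr) := Classical.decEq _

section Arithmetic

variable {Arr : Type u} {b : Bool} {S : Stk Arr → List Bool} {n : ℕ}

open Stk

/-- Multiplies the unary number on the stack `k` by the size. -/
noncomputable def mulSize (k : Stk Arr) : Prog (Stk Arr) :=
  .seq (drain k (copy tmp size aux)) (move aux k)

theorem does_mulSize {k : Stk Arr} {m : ℕ} (h₁ : k ≠ tmp) (h₂ : k ≠ aux) (h₃ : k ≠ size)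
    (hs : S size = un n) (ht : S tmp = []) (ha : S aux = []) (hk : S k = un m) :
    Does (mulSize k) b S b (Function.update S k (un (m * n))) ((10 * n + 6) * m + 4) := by
  have h := does_drain (k := k) (p := copy tmp size aux) (T := 7 * n + 4) (un m) (fun _ => b)
    (fun l => Function.update (Function.update S aux (un ((m - l.length) * n))) k l) (by simp)
    (fun x l hl => by
      refine Does.of (does_copy (by simp) (by simp) (by simp) (by simp [h₁.symm, ht])) rfl ?_ ?_ _
      · have : l.length + 1 ≤ m := by simpa using hl.length_le
        obtain ⟨d, rfl⟩ := Nat.exists_eq_add_of_le this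
        funext j
        by_cases hj : j = aux
        · subst hj
          have e₁ : l.length + 1 + d - l.length = d + 1 := by omega
          have e₂ : l.length + 1 + d - (l.length + 1) = d := by omega
          simp [h₂.symm, h₃.symm, hs, e₁, e₂, List.replicate_append_replicate, add_mul]
          ring
        · by_cases hj' : j = k
          · subst hj'; simp [h₂]
          · simp [hj, hj']
      · simp [h₃.symm, hs])
  have h0 : Function.update (Function.update S aux (un ((m - (un m).length) * n))) k (un m) =
      S := by
    funext j
    by_cases hj : j = aux <;> by_cases hj' : j = k <;> simp_all
  rw [h0] at h
  refine Does.of (h.seq (does_move h₂.symm)) rfl ?_ ?_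
  · have h₄ := h₂.symm
    funext j
    by_cases hj : j = aux <;> by_cases hj' : j = k <;>
      simp_all
  · simp [h₂.symm]; ring_nf; omega

/-- Computes on the stack `addr` the number whose digits to the base `n`, least significant first,
are held by the given counters. -/
noncomputable def address : List ℕ → Prog (Stk Arr)
  | [] => skip
  | i :: is => .seq (address is) (.seq (mulSize addr) (copy tmp (ctr i) addr))

/-- The number with the digits `x i`, for `i` in the list, to the base `n`. -/
def horner (n : ℕ) (x : ℕ → ℕ) : List ℕ → ℕ
  | [] => 0
  | i :: is => horner n x is * n + x i

theorem horner_lt {x : ℕ → ℕ} {is : List ℕ} (h : ∀ i ∈ is, x i < n) :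
    horner n x is < n ^ is.length := by
  induction is with
  | nil => simp [horner]
  | cons i is ih =>
    have h₁ := ih fun j hj => h j (by simp [hj])
    have h₂ := h i (by simp)
    simp only [horner, List.length_cons, pow_succ]
    calc _ < horner n x is * n + n := by omega
      _ = (horner n x is + 1) * n := by ring
      _ ≤ _ := Nat.mul_le_mul_right _ h₁

/-- A bound for the running time of `address`. -/
noncomputable def addressTime : ℕ → Polynomial ℕ
  | 0 => 1
  | k + 1 => addressTime k + (10 * Polynomial.X + 6) * Polynomial.X ^ k + 7 * Polynomial.X + 8

theorem does_address {x : ℕ → ℕ} {is : List ℕ} (hs : S size = un n) (ht : S tmp = [])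
    (ha : S aux = []) (had : S addr = []) (hx : ∀ i ∈ is, x i < n)
    (hc : ∀ i ∈ is, S (ctr i) = un (x i)) :
    Does (address is) b S b (Function.update S addr (un (horner n x is)))
      ((addressTime is.length).eval n) := by
  induction is with
  | nil =>
    refine Does.of does_skip rfl ?_ (by simp [addressTime])
    simp [horner, ← had]
  | cons i is ih =>
    have h₁ := ih (fun j hj => hx j (by simp [hj])) (fun j hj => hc j (by simp [hj]))
    have hlt := horner_lt (n := n) (x := x) (is := is) fun j hj => hx j (by simp [hj])
    have hi := hx i (by simp)
    have h₂ := does_mulSize (b := b) (n := n) (m := horner n x is)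
      (S := Function.update S addr (un (horner n x is))) (k := addr)
      (by simp) (by simp) (by simp) (by simp [hs]) (by simp [ht]) (by simp [ha]) (by simp)
    refine Does.of (h₁.seq (h₂.seq (does_copy (by simp) (by simp) (by simp) (by simp [ht])))) rfl
      ?_ ?_
    · simp [hc, horner, List.replicate_append_replicate, add_comm]
    · simp only [List.length_cons, addressTime, Polynomial.eval_add, Polynomial.eval_mul,
        Polynomial.eval_pow, Polynomial.eval_X, Polynomial.eval_ofNat]
      have : (10 * n + 6) * horner n x is ≤ (10 * n + 6) * n ^ is.length := by gcongr
      simp [hc]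
      omega

/-- Computes `n ^ k` on the stack `iter`. -/
noncomputable def power : ℕ → Prog (Stk Arr)
  | 0 => pushBit iter true
  | k + 1 => .seq (power k) (mulSize iter)

/-- A bound for the running time of `power`. -/
noncomputable def powerTime : ℕ → Polynomial ℕ
  | 0 => 1
  | k + 1 => powerTime k + (10 * Polynomial.X + 6) * Polynomial.X ^ k + 4

theorem does_power (k : ℕ) (hs : S size = un n) (ht : S tmp = []) (ha : S aux = [])
    (hi : S iter = []) :
    Does (power k) b S b (Function.update S iter (un (n ^ k))) ((powerTime k).eval n) := by
  induction k with
  | zero =>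
    refine Does.of (does_pushBit _ _) rfl ?_ (by simp [powerTime])
    simp [hi]
  | succ k ih =>
    refine Does.of (ih.seq (does_mulSize (n := n) (m := n ^ k) (by simp) (by simp) (by simp)
      (by simp [hs]) (by simp [ht]) (by simp [ha]) (by simp))) rfl ?_ ?_
    · simp [pow_succ]
    · simp [powerTime]; omega

end Arithmetic

end StackProgram

/-! ### First-order tests on tables -/

namespace StackProgram

section Tests

variable {Arr : Type u}

open Stk
open scoped Classical

/-- The stacks `S` are ready for a test: the size is `n`, the variables numbered below `ℓ` have the
values `x`, the other counters and the auxiliary stacks are empty. -/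
structure Frame {ℓ n : ℕ} (x : Fin ℓ → Fin n) (S : Stk Arr → List Bool) : Prop where
  size : S size = un n
  addr : S addr = []
  tmp : S tmp = []
  aux : S aux = []
  ctr_lt : ∀ i : Fin ℓ, S (ctr i) = un (x i)
  ctr_ge : ∀ i, ℓ ≤ i → S (ctr i) = []

/-- The contents of the tables. -/
def tables (S : Stk Arr → List Bool) : Arr → List Bool := fun a => S (arr a)

/-- The relation described by the table `a`: its bits are listed in the order in which
`FinCSP.encodeRel` lists tuples. -/
def Holds (s : Arr → List Bool) (a : Arr) {n k : ℕ} (x : Fin k → Fin n) : Prop :=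
  (s a).getD (finFunctionFinEquiv x) false = true

/-- The property `T` of the values of `ℓ` variables and of the tables can be tested in time
polynomial in the size: some program sets the flag to its truth value and leaves the stacks
unchanged. -/
def PolyTest (ℓ : ℕ) (T : (n : ℕ) → (Fin ℓ → Fin n) → (Arr → List Bool) → Prop) : Prop :=
  ∃ P : Prog (Stk Arr), ∃ p : Polynomial ℕ, ∀ (n : ℕ) (x : Fin ℓ → Fin n) (S : Stk Arr → List Bool),
    Frame x S → ∀ b, Does P b S (decide (T n x (tables S))) S (p.eval n)

theorem PolyTest.congr {ℓ : ℕ} {T T' : (n : ℕ) → (Fin ℓ → Fin n) → (Arr → List Bool) → Prop}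
    (h : PolyTest ℓ T) (hT : ∀ n x s, T n x s ↔ T' n x s) : PolyTest ℓ T' := by
  have : T = T' := by
    funext n x s
    exact propext (hT n x s)
  exact this ▸ h

theorem PolyTest.const (ℓ : ℕ) (c : Prop) : PolyTest (Arr := Arr) ℓ fun _ _ _ => c := by
  exact ⟨setFlag fun _ => decide c, 1, fun n x S _ b => by simpa using does_setFlag _⟩

theorem PolyTest.not {ℓ : ℕ} {T : (n : ℕ) → (Fin ℓ → Fin n) → (Arr → List Bool) → Prop}
    (h : PolyTest ℓ T) : PolyTest ℓ fun n x s => ¬ T n x s := by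
  obtain ⟨P, p, hP⟩ := h
  refine ⟨.seq P (setFlag fun b => !b), p + 1, fun n x S hS b => ?_⟩
  exact Does.of ((hP n x S hS b).seq (does_setFlag _)) (by simp) rfl (by simp)

theorem PolyTest.and {ℓ : ℕ} {T T' : (n : ℕ) → (Fin ℓ → Fin n) → (Arr → List Bool) → Prop}
    (h : PolyTest ℓ T) (h' : PolyTest ℓ T') : PolyTest ℓ fun n x s => T n x s ∧ T' n x s := by
  obtain ⟨P, p, hP⟩ := h
  obtain ⟨P', p', hP'⟩ := h'
  refine ⟨.seq P (ifFlag P' skip), p + p' + 2, fun n x S hS b => ?_⟩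
  have h₁ := hP n x S hS b
  by_cases hT : T n x (tables S)
  · rw [decide_eq_true hT] at h₁
    exact Does.of (h₁.seq (does_ifFlag_true (hP' n x S hS true))) (by simp [hT]) rfl
      (by simp; omega)
  · rw [decide_eq_false hT] at h₁
    exact Does.of (h₁.seq (does_ifFlag_false does_skip)) (by simp [hT]) rfl (by simp)

theorem PolyTest.or {ℓ : ℕ} {T T' : (n : ℕ) → (Fin ℓ → Fin n) → (Arr → List Bool) → Prop}
    (h : PolyTest ℓ T) (h' : PolyTest ℓ T') : PolyTest ℓ fun n x s => T n x s ∨ T' n x s :=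
  (h.not.and h'.not).not.congr fun n x s => by tauto

theorem PolyTest.exists_finite {ℓ : ℕ} {ι : Type*} [Finite ι]
    {T : ι → (n : ℕ) → (Fin ℓ → Fin n) → (Arr → List Bool) → Prop}
    (h : ∀ i, PolyTest ℓ (T i)) : PolyTest ℓ fun n x s => ∃ i, T i n x s := by
  have := Fintype.ofFinite ι
  have key : ∀ F : Finset ι, PolyTest ℓ fun n x s => ∃ i ∈ F, T i n x s := by
    intro F
    induction F using Finset.induction_on with
    | empty => exact (PolyTest.const ℓ False).congr fun n x s => by simp
    | insert a F _ ih => exact ((h a).or ih).congr fun n x s => by simp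
  exact (key Finset.univ).congr fun n x s => by simp

theorem PolyTest.forall_finite {ℓ : ℕ} {ι : Type*} [Finite ι]
    {T : ι → (n : ℕ) → (Fin ℓ → Fin n) → (Arr → List Bool) → Prop}
    (h : ∀ i, PolyTest ℓ (T i)) : PolyTest ℓ fun n x s => ∀ i, T i n x s :=
  (PolyTest.exists_finite fun i => (h i).not).not.congr fun n x s => by simp

theorem horner_ofFn (n : ℕ) (x : ℕ → ℕ) {k : ℕ} (τ : Fin k → ℕ) :
    horner n x (List.ofFn τ) = ∑ j, x (τ j) * n ^ (j : ℕ) := by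
  induction k with
  | zero => simp [horner]
  | succ k ih =>
    rw [List.ofFn_succ, horner, ih, Fin.sum_univ_succ, Finset.sum_mul, add_comm]
    simp [pow_succ, mul_assoc]

/-- Sets the flag to the bit of the table `a` at the given tuple of variables. -/
noncomputable def lookup (a : Arr) (is : List ℕ) : Prog (Stk Arr) :=
  .seq (address is) <|
  .seq (drain addr (.seq (popBit (arr a)) (ifPopped (pushPopped tmp) skip))) <|
  .seq (.pop (arr a) fun _ x => (x.getD false, x)) <|
  .seq (ifPopped (pushPopped (arr a)) skip) (move tmp (arr a))

theorem does_lookup {a : Arr} {n : ℕ} {x : ℕ → ℕ} {is : List ℕ} {b : Bool}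
    {S : Stk Arr → List Bool} (hs : S size = un n) (ht : S tmp = [])
    (ha : S aux = []) (had : S addr = []) (hx : ∀ i ∈ is, x i < n)
    (hc : ∀ i ∈ is, S (ctr i) = un (x i)) :
    Does (lookup a is) b S ((S (arr a)).getD (horner n x is) false) S
      ((addressTime is.length + 8 * Polynomial.X ^ is.length + 7).eval n) := by
  have hlt := horner_lt hx
  have h₁ := does_address (b := b) hs ht ha had hx hc
  generalize horner n x is = v at *
  have h₂ := does_drain (k := addr) (p := .seq (popBit (arr a)) (ifPopped (pushPopped tmp) skip))
    (T := 3) (un v) (fun _ => b)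
    (fun m => Function.update (Function.update (Function.update S (arr a)
      ((S (arr a)).drop (v - m.length))) tmp ((S (arr a)).take (v - m.length)).reverse) addr m)
    (by simp)
    (fun y m hm => by
      have hm' : m.length + 1 ≤ v := by simpa using hm.length_le
      obtain ⟨d, rfl⟩ := Nat.exists_eq_add_of_le hm'
      have e₁ : m.length + 1 + d - m.length = d + 1 := by omega
      have e₂ : m.length + 1 + d - (y :: m).length = d := by
        rw [List.length_cons]; omega
      rw [e₁, e₂]
      refine does_popBit_seq (T := 2) ?_ _
      rcases hd : (S (arr a)).drop d with _ | ⟨z, l⟩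
      · have e₃ : (S (arr a)).drop (d + 1) = [] := by
          rw [← List.drop_drop, hd]; rfl
        have e₄ : (S (arr a)).take (d + 1) = (S (arr a)).take d := by
          rw [List.take_of_length_le, List.take_of_length_le]
          · simpa using hd
          · have : (S (arr a)).length ≤ d := by simpa using hd
            omega
        simp only [ne_eq, reduceCtorEq, not_false_eq_true, Function.update_of_ne,
          Function.update_self, List.head?_nil]
        refine doesAt_ifPopped_none ?_
        refine DoesAt.of (does_skip none) rfl ?_ (by omega)
        rw [e₃, e₄]
        funext j
        by_cases h₁ : j = addr <;> by_cases h₂ : j = tmp <;> by_cases h₃ : j = arr a <;>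
          simp_all
      · have e₃ : (S (arr a)).drop (d + 1) = l := by
          rw [← List.drop_drop, hd]; rfl
        have e₄ : (S (arr a)).take (d + 1) = (S (arr a)).take d ++ [z] := by
          rw [List.take_add, hd]; rfl
        simp only [ne_eq, reduceCtorEq, not_false_eq_true, Function.update_of_ne,
          Function.update_self, List.head?_cons]
        refine doesAt_ifPopped_some ?_
        refine DoesAt.of (doesAt_pushPopped tmp z) rfl ?_ (by omega)
        rw [e₃, e₄]
        funext j
        by_cases h₁ : j = addr <;> by_cases h₂ : j = tmp <;> by_cases h₃ : j = arr a <;>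
          simp_all)
  have h0 : Function.update (Function.update (Function.update S (arr a)
      ((S (arr a)).drop (v - (un v).length))) tmp ((S (arr a)).take (v - (un v).length)).reverse)
      addr (un v) = Function.update S addr (un v) := by
    funext j
    by_cases h₁ : j = addr <;> by_cases h₂ : j = tmp <;> by_cases h₃ : j = arr a <;>
      simp_all
  rw [h0] at h₂
  simp only [List.length_nil, Nat.sub_zero, List.length_replicate] at h₂
  set S₂ := Function.update (Function.update (Function.update S (arr a)
      ((S (arr a)).drop v)) tmp ((S (arr a)).take v).reverse) addr [] with hS₂
  -- reading the bit at the top and putting it back leaves the stacks unchanged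
  have h₃ : Does (.seq (.pop (arr a) fun _ x => (x.getD false, x))
      (ifPopped (pushPopped (arr a)) skip)) b S₂ ((S (arr a)).getD v false) S₂ 3 := by
    intro o
    have hp := Runs.pop (arr a) (fun _ x => (x.getD false, x)) (b, o) S₂
    have e : S₂ (arr a) = (S (arr a)).drop v := by simp [S₂]
    have e' : ((S₂ (arr a)).head?).getD false = (S (arr a)).getD v false := by
      rw [e]; simp [List.head?_drop]
    have key : DoesAt (ifPopped (pushPopped (arr a)) skip) (S₂ (arr a)).head?
        ((S (arr a)).getD v false) (Function.update S₂ (arr a) (S₂ (arr a)).tail)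
        ((S (arr a)).getD v false) S₂ 2 := by
      rcases hd : S₂ (arr a) with _ | ⟨z, l⟩
      · refine doesAt_ifPopped_none (T := 1) ?_
        refine DoesAt.of (does_skip none) rfl ?_ le_rfl
        rw [List.tail_nil, ← hd, Function.update_eq_self]
      · refine doesAt_ifPopped_some ?_
        refine DoesAt.of (doesAt_pushPopped (arr a) z) rfl ?_ le_rfl
        simp [hd, Function.update_eq_self_iff]
    obtain ⟨o', t, ht', hr⟩ := key
    refine ⟨o', 1 + t, by omega, ?_⟩
    rw [e'] at hp
    exact hp.seq hr
  have h₄ := does_move (b := (S (arr a)).getD v false) (S := S₂) (k := tmp) (k' := arr a) (by simp)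
  have h₅ : Does (.seq (.pop (arr a) fun _ x => (x.getD false, x))
      (.seq (ifPopped (pushPopped (arr a)) skip) (move tmp (arr a)))) b S₂
      ((S (arr a)).getD v false)
      (Function.update (Function.update S₂ tmp []) (arr a) ((S₂ tmp).reverse ++ S₂ (arr a)))
      (3 + (3 * (S₂ tmp).length + 2)) := by
    intro o
    obtain ⟨o', t, ht', hr⟩ := h₃ o
    obtain ⟨o'', t', ht'', hr'⟩ := h₄ o'
    cases hr with
    | @seq _ _ _ c _ t₁ t₂ h₁ h₂ => exact ⟨o'', t₁ + (t₂ + t'), by omega, h₁.seq (h₂.seq hr')⟩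
  refine Does.of (h₁.seq (h₂.seq h₅)) rfl ?_ ?_
  · have e : ∀ l : List Bool, (l.take v).reverse.reverse ++ l.drop v = l := by simp
    funext j
    by_cases h₁ : j = addr <;> by_cases h₂ : j = tmp <;> by_cases h₃ : j = arr a <;>
      simp_all
  · have : (S₂ tmp).length ≤ v := by simp [S₂]
    simp
    omega

theorem PolyTest.holds {ℓ k : ℕ} (a : Arr) (σ : Fin k → Fin ℓ) :
    PolyTest ℓ fun _ x s => Holds s a fun i => x (σ i) := by
  refine ⟨lookup a (List.ofFn fun i => (σ i : ℕ)),
    addressTime k + 8 * Polynomial.X ^ k + 7, fun n x S hS b => ?_⟩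
  have h := does_lookup (a := a) (b := b) (x := fun i => if h : i < ℓ then x ⟨i, h⟩ else 0)
    (is := List.ofFn fun i => (σ i : ℕ)) hS.size hS.tmp hS.aux hS.addr
    (by
      intro i hi
      obtain ⟨j, rfl⟩ := (List.mem_ofFn' _ _).1 hi
      simp)
    (by
      intro i hi
      obtain ⟨j, rfl⟩ := (List.mem_ofFn' _ _).1 hi
      simp [hS.ctr_lt])
  refine Does.of h ?_ rfl (by simp)
  rw [horner_ofFn]
  simp [Holds, tables]

/-- Sets the flag according to whether the value of the variable `i` is at most that of `j`. -/
noncomputable def compareVars (i j : ℕ) : Prog (Stk Arr) :=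
  .seq (copy tmp (ctr i) addr) <|
  .seq (copy tmp (ctr j) aux) <|
  .seq (setFlag fun _ => true) <|
  .seq (drain addr (.seq (popBit aux) (ifPopped skip (setFlag fun _ => false)))) (clear aux)

theorem PolyTest.le {ℓ : ℕ} (i j : Fin ℓ) :
    PolyTest (Arr := Arr) ℓ fun _ x _ => x i ≤ x j := by
  refine ⟨compareVars i j, 22 * Polynomial.X + 13, fun n x S hS b => ?_⟩
  have h₁ := does_copy (b := b) (S := S) (tmp := tmp) (k := ctr i) (k' := addr)
    (by simp) (by simp) (by simp) hS.tmp
  rw [hS.addr, hS.ctr_lt] at h₁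
  have h₂ := does_copy (b := b) (S := Function.update S addr (un (x i))) (tmp := tmp) (k := ctr j)
    (k' := aux) (by simp) (by simp) (by simp) (by simp [hS.tmp])
  have h₃ := does_drain (k := addr)
    (p := .seq (popBit aux) (ifPopped skip (setFlag fun _ => false)))
    (T := 3) (un (x i)) (fun m => decide ((x i : ℕ) - m.length ≤ x j))
    (fun m => Function.update (Function.update S aux (un (x j - (x i - m.length)))) addr m)
    (by simp)
    (fun y m hm => by
      have hm' : m.length + 1 ≤ x i := by simpa using hm.length_le
      refine does_popBit_seq (T := 2) ?_ _
      obtain ⟨d, hd⟩ := Nat.exists_eq_add_of_le hm'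
      have e₁ : (x i : ℕ) - m.length = d + 1 := by omega
      have e₂ : (x i : ℕ) - (y :: m).length = d := by
        rw [List.length_cons]; omega
      rw [e₁, e₂]
      rcases Nat.lt_or_ge d (x j) with hlt | hge
      · obtain ⟨c, hc⟩ := Nat.exists_eq_add_of_lt hlt
        have e₃ : (x j : ℕ) - (d + 1) = c := by omega
        have e₄ : (x j : ℕ) - d = c + 1 := by omega
        have f₁ : decide (d ≤ (x j : ℕ)) = true := by simp; omega
        have f₂ : decide (d + 1 ≤ (x j : ℕ)) = true := by simp; omega
        rw [e₃, e₄, f₁, f₂]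
        simp only [ne_eq, reduceCtorEq, not_false_eq_true, Function.update_of_ne,
          Function.update_self, List.replicate_succ, List.head?_cons]
        refine doesAt_ifPopped_some ?_
        refine DoesAt.of (does_skip (some true)) rfl ?_ (by omega)
        funext j
        by_cases h₁ : j = addr <;> by_cases h₂ : j = aux <;> simp_all
      · have e₃ : (x j : ℕ) - (d + 1) = 0 := by omega
        have e₄ : (x j : ℕ) - d = 0 := by omega
        have f₂ : decide (d + 1 ≤ (x j : ℕ)) = false := by simp; omega
        rw [e₃, e₄, f₂]
        simp only [ne_eq, reduceCtorEq, not_false_eq_true, Function.update_of_ne,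
          Function.update_self, List.replicate_zero, List.head?_nil]
        refine doesAt_ifPopped_none ?_
        refine DoesAt.of (does_setFlag (fun _ => false) none) rfl ?_ (by omega)
        funext j
        by_cases h₁ : j = addr <;> by_cases h₂ : j = aux <;> simp_all)
  have h0 : Function.update (Function.update S aux (un (x j - (x i - (un (x i)).length))))
      addr (un (x i)) = Function.update (Function.update S addr (un (x i))) aux (un (x j)) := by
    funext j
    by_cases h₁ : j = addr <;> by_cases h₂ : j = aux <;> simp_all
  have h0' : decide ((x i : ℕ) - (un (x i)).length ≤ x j) = true := by simp
  rw [h0, h0'] at h₃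
  simp only [ne_eq, reduceCtorEq, not_false_eq_true, Function.update_of_ne, hS.aux, hS.ctr_lt,
    List.reverse_replicate, List.append_nil] at h₁ h₂
  refine Does.of (h₁.seq (h₂.seq ((does_setFlag fun _ => true).seq (h₃.seq (does_clear aux)))))
    (by simp) ?_ ?_
  · have := hS.aux
    have := hS.addr
    funext j
    by_cases h₁ : j = addr <;> by_cases h₂ : j = aux <;> simp_all
  · have := (x i).isLt
    have := (x j).isLt
    simp
    omega

theorem PolyTest.eq {ℓ : ℕ} (i j : Fin ℓ) :
    PolyTest (Arr := Arr) ℓ fun _ x _ => x i = x j :=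
  ((PolyTest.le i j).and (PolyTest.le j i)).congr fun n x s => by
    simpa using (le_antisymm_iff (a := x i) (b := x j)).symm

end Tests

end StackProgram

/-! ### Loops over the elements of the structure -/

namespace StackProgram

section Loops

variable {Arr : Type u}

open Stk
open scoped Classical

/-- Runs `p` with the variable `i` ranging over `n - 1, …, 0`. -/
noncomputable def forSize (i : ℕ) (p : Prog (Stk Arr)) : Prog (Stk Arr) :=
  .seq (copy tmp size (ctr i)) (drain (ctr i) p)

/-- The flag and the stacks before the rounds for the values below `c` are given by `B c` and
`F c`. -/
theorem does_forSize {i n T : ℕ} {p : Prog (Stk Arr)} (B : ℕ → Bool)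
    (F : ℕ → Stk Arr → List Bool) (hs : F n size = un n) (ht : F n tmp = [])
    (hc : ∀ c, F c (ctr i) = [])
    (hp : ∀ c < n, Does p (B (c + 1)) (Function.update (F (c + 1)) (ctr i) (un c)) (B c)
      (Function.update (F c) (ctr i) (un c)) T) :
    Does (forSize i p) (B n) (F n) (B 0) (F 0) ((T + 9) * n + 6) := by
  have h₁ := does_copy (b := B n) (S := F n) (tmp := tmp) (k := size) (k' := ctr i)
    (by simp) (by simp) (by simp) ht
  have h₂ := does_drain (k := ctr i) (p := p) (T := T) (un n) (fun l => B l.length)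
    (fun l => Function.update (F l.length) (ctr i) l) (by simp)
    (fun x l hl => by
      have hlen : l.length + 1 ≤ n := by simpa using hl.length_le
      have hl' : l = un l.length := by
        refine List.eq_replicate_length.2 fun y hy => ?_
        have := hl.subset (List.mem_cons_of_mem x hy)
        exact List.eq_of_mem_replicate this
      have := hp l.length hlen
      rw [← hl'] at this
      simpa using this (some x))
  simp only [List.length_replicate, List.length_nil, hs, List.reverse_replicate, hc,
    List.append_nil] at h₁ h₂
  refine Does.of (h₁.seq h₂) rfl ?_ ?_
  · rw [← hc 0, Function.update_eq_self]
  · ring_nf; omega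

theorem PolyTest.exists {ℓ : ℕ} {T : (n : ℕ) → (Fin (ℓ + 1) → Fin n) → (Arr → List Bool) → Prop}
    (h : PolyTest (ℓ + 1) T) : PolyTest ℓ fun n x s => ∃ y, T n (Fin.snoc x y) s := by
  obtain ⟨P, p, hP⟩ := h
  refine ⟨.seq (setFlag fun _ => false) (forSize ℓ (ifFlag skip P)),
    (p + 11) * Polynomial.X + 7, fun n x S hS b => ?_⟩
  have h := does_forSize (i := ℓ) (n := n) (T := p.eval n + 2) (p := ifFlag skip P)
    (fun c => decide (∃ y : Fin n, c ≤ y ∧ T n (Fin.snoc x y) (tables S))) (fun _ => S)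
    hS.size hS.tmp (fun _ => hS.ctr_ge ℓ le_rfl)
    (fun c hc => by
      by_cases hT : ∃ y : Fin n, c + 1 ≤ y ∧ T n (Fin.snoc x y) (tables S)
      · have hT' : ∃ y : Fin n, c ≤ y ∧ T n (Fin.snoc x y) (tables S) := by
          obtain ⟨y, hy, h⟩ := hT
          exact ⟨y, by omega, h⟩
        rw [decide_eq_true hT, decide_eq_true hT']
        exact (does_ifFlag_true does_skip).mono (by omega)
      · rw [decide_eq_false hT]
        have hF : Frame (Fin.snoc x ⟨c, hc⟩ : Fin (ℓ + 1) → Fin n)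
            (Function.update S (ctr ℓ) (un c)) := by
          constructor
          · simpa using hS.size
          · simpa using hS.addr
          · simpa using hS.tmp
          · simpa using hS.aux
          · intro i
            refine Fin.lastCases ?_ (fun j => ?_) i
            · simp
            · simpa [j.isLt.ne] using hS.ctr_lt j
          · intro i hi
            have : i ≠ ℓ := by omega
            simpa [this] using hS.ctr_ge i (by omega)
        have htab : tables (Function.update S (ctr ℓ) (un c)) = tables S := by
          funext a; simp [tables]
        have := hP n _ _ hF false
        rw [htab] at this
        refine Does.of (does_ifFlag_false this) ?_ rfl (by omega)
        rw [decide_eq_decide]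
        constructor
        · exact fun h => ⟨⟨c, hc⟩, le_rfl, h⟩
        · rintro ⟨y, hy, h⟩
          rcases hy.eq_or_lt with h' | h'
          · have : (⟨c, hc⟩ : Fin n) = y := Fin.ext h'
            rwa [this]
          · exact absurd ⟨y, h', h⟩ hT)
  have h0 : decide (∃ y : Fin n, n ≤ y ∧ T n (Fin.snoc x y) (tables S)) = false := by
    rw [decide_eq_false]
    rintro ⟨y, hy, _⟩
    omega
  rw [h0] at h
  refine Does.of ((does_setFlag fun _ => false).seq h) ?_ rfl ?_
  · simp
  · simp; ring_nf; omega

theorem PolyTest.exists_tuple {ℓ : ℕ} (m : ℕ)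
    {T : (n : ℕ) → (Fin (ℓ + m) → Fin n) → (Arr → List Bool) → Prop}
    (h : PolyTest (ℓ + m) T) :
    PolyTest ℓ fun n x s => ∃ y : Fin m → Fin n, T n (Fin.append x y) s := by
  induction m with
  | zero =>
    refine h.congr fun n x s => ?_
    simp [Unique.exists_iff, Fin.append_right_nil]
  | succ m ih =>
    refine (ih (T := fun n x s => ∃ c, T n (Fin.snoc x c : Fin (ℓ + m + 1) → Fin n) s)
      (PolyTest.exists h)).congr fun n x s => ?_
    constructor
    · rintro ⟨y, c, h⟩
      exact ⟨Fin.snoc y c, by rwa [Fin.append_snoc]⟩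
    · rintro ⟨y, h⟩
      refine ⟨Fin.init y, y (Fin.last m), ?_⟩
      rwa [← Fin.append_snoc, Fin.snoc_init_self]

theorem PolyTest.forall_tuple {ℓ : ℕ} (m : ℕ)
    {T : (n : ℕ) → (Fin (ℓ + m) → Fin n) → (Arr → List Bool) → Prop}
    (h : PolyTest (ℓ + m) T) :
    PolyTest ℓ fun n x s => ∀ y : Fin m → Fin n, T n (Fin.append x y) s :=
  (PolyTest.exists_tuple m h.not).not.congr fun n x s => by simp

theorem PolyTest.forall {ℓ : ℕ} {T : (n : ℕ) → (Fin (ℓ + 1) → Fin n) → (Arr → List Bool) → Prop}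
    (h : PolyTest (ℓ + 1) T) : PolyTest ℓ fun n x s => ∀ y, T n (Fin.snoc x y) s :=
  (PolyTest.exists h.not).not.congr fun n x s => by simp

/-- The rounds of a loop over all `k`-tuples: the variables `0, …, k - 1` run through all values,
the last one outermost. -/
noncomputable def forTuples (p : Prog (Stk Arr)) : ℕ → Prog (Stk Arr)
  | 0 => p
  | k + 1 => forSize k (forTuples p k)

/-- The stacks `S` with the first counters set to the given values. -/
def withCtr {k n : ℕ} (S : Stk Arr → List Bool) (x : Fin k → Fin n) : Stk Arr → List Bool
  | ctr i => if h : i < k then un (x ⟨i, h⟩) else S (ctr i)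
  | q => S q

theorem withCtr_update {k n : ℕ} (S : Stk Arr → List Bool) (x : Fin k → Fin n) (c : Fin n) :
    withCtr (Function.update S (ctr k) (un c)) x =
      withCtr S (Fin.snoc x c : Fin (k + 1) → Fin n) := by
  funext q
  cases q with
  | ctr i =>
    rcases lt_trichotomy i k with h | h | h
    · have h' : i < k + 1 := by omega
      have : (Fin.snoc x c : Fin (k + 1) → Fin n) ⟨i, h'⟩ = x ⟨i, h⟩ :=
        Fin.snoc_castSucc (α := fun _ => Fin n) c x ⟨i, h⟩
      simp [withCtr, h, h', this]
    · subst h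
      have : (Fin.snoc x c : Fin (i + 1) → Fin n) ⟨i, i.lt_succ_self⟩ = c :=
        Fin.snoc_last (α := fun _ => Fin n) c x
      simp [withCtr, this]
    · have h₁ : ¬ i < k := by omega
      have h₂ : ¬ i < k + 1 := by omega
      have h₃ : i ≠ k := by omega
      simp [withCtr, h₁, h₂, h₃]
  | _ => simp [withCtr]

/-- The characteristic string of a relation of arity `k + 1` is the concatenation of those of its
sections at the values of the last coordinate. -/
theorem encodeRel_succ {n k : ℕ} (R : (Fin (k + 1) → Fin n) → Prop) :
    FinCSP.encodeRel R =
      (List.finRange n).flatMap fun c => FinCSP.encodeRel fun x => R (Fin.snoc x c) := by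
  have hmul : n ^ (k + 1) = n ^ k * n := pow_succ n k
  rw [FinCSP.encodeRel, List.ofFn_congr hmul, List.ofFn_mul', List.flatMap, ← List.ofFn_eq_map]
  congr 2
  funext c
  rw [FinCSP.encodeRel]
  congr 1
  funext j
  congr 2
  rw [Equiv.symm_apply_eq]
  ext
  rw [finFunctionFinEquiv_apply, Fin.sum_univ_castSucc]
  simp only [Fin.snoc_castSucc, Fin.snoc_last, Fin.val_castSucc, Fin.val_last]
  rw [← finFunctionFinEquiv_apply, Equiv.apply_symm_apply]
  simp
  ring

theorem length_encodeRel {n k : ℕ} (R : (Fin k → Fin n) → Prop) :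
    (FinCSP.encodeRel R).length = n ^ k := by
  simp [FinCSP.encodeRel]

/-- A bound for the running time of `forTuples`. -/
noncomputable def forTuplesTime (p : Polynomial ℕ) : ℕ → Polynomial ℕ
  | 0 => p
  | k + 1 => (forTuplesTime p k + 9) * Polynomial.X + 6

/-- If `p` pushes the truth value of `R` at the values of the variables on the stack `new`, then
the loop over all tuples pushes the characteristic string of `R`. -/
theorem does_forTuples {k n : ℕ} {p : Prog (Stk Arr)} {T : Polynomial ℕ}
    {S : Stk Arr → List Bool} (R : (Fin k → Fin n) → Prop)
    (hs : S size = un n) (ht : S tmp = []) (hc : ∀ i < k, S (ctr i) = [])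
    (hp : ∀ x l, Does p true (Function.update (withCtr S x) new l) true
      (Function.update (withCtr S x) new (decide (R x) :: l)) (T.eval n)) (l : List Bool) :
    Does (forTuples p k) true (Function.update S new l) true
      (Function.update S new (FinCSP.encodeRel R ++ l)) ((forTuplesTime T k).eval n) := by
  induction k generalizing S l with
  | zero =>
    have e : ∀ x : Fin 0 → Fin n, withCtr S x = S := by
      intro x; funext q; cases q <;> simp [withCtr]
    have := hp Fin.elim0 l
    rw [e] at this
    refine Does.of this rfl ?_ le_rfl
    have : FinCSP.encodeRel R = [decide (R Fin.elim0)] := by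
      rw [FinCSP.encodeRel, List.ofFn_congr (pow_zero n)]
      simp [List.ofFn_succ, Subsingleton.elim _ (Fin.elim0 : Fin 0 → Fin n)]
    simp [this]
  | succ k ih =>
    let G : ℕ → List Bool := fun c => ((List.finRange n).drop c).flatMap fun c =>
      FinCSP.encodeRel fun x => R (Fin.snoc x c)
    have h := does_forSize (i := k) (n := n) (T := (forTuplesTime T k).eval n) (p := forTuples p k)
      (fun _ => true) (fun c => Function.update S new (G c ++ l)) (by simpa using hs)
      (by simpa using ht) (fun c => by simpa using hc k (by omega))
      (fun c hcn => by
        have := ih (S := Function.update S (ctr k) (un c)) (fun x => R (Fin.snoc x ⟨c, hcn⟩))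
          (by simpa using hs) (by simpa using ht)
          (fun i hi => by simpa [hi.ne] using hc i (by omega))
          (fun x l' => by
            have := withCtr_update S x ⟨c, hcn⟩
            simp only at this
            rw [this]
            exact hp _ l') (G (c + 1) ++ l)
        have hG : G c = (FinCSP.encodeRel fun x => R (Fin.snoc x ⟨c, hcn⟩)) ++ G (c + 1) := by
          simp only [G]
          rw [List.drop_eq_getElem_cons (by simpa using hcn), List.flatMap_cons]
          simp
        have e : ∀ l', Function.update (Function.update S new l') (ctr k) (un c) =
            Function.update (Function.update S (ctr k) (un c)) new l' :=
          fun l' => Function.update_comm (by simp) _ _ _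
        rw [hG, List.append_assoc, e, e]
        exact this)
    have h₀ : G 0 = FinCSP.encodeRel R := by simp [G, encodeRel_succ R]
    have h₁ : G n = [] := by simp [G, List.drop_of_length_le]
    rw [h₀, h₁] at h
    exact Does.of h rfl rfl (by simp [forTuplesTime])

/-- The stacks `S` are ready for a computation: the size is `n`, all counters and auxiliary stacks
are empty. -/
abbrev Ready (n : ℕ) (S : Stk Arr → List Bool) : Prop :=
  Frame (Fin.elim0 : Fin 0 → Fin n) S

theorem Ready.frame {k n : ℕ} {S : Stk Arr → List Bool} (hS : Ready n S) (x : Fin k → Fin n)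
    (l : List Bool) : Frame x (Function.update (withCtr S x) new l) := by
  constructor
  · simpa [withCtr] using hS.size
  · simpa [withCtr] using hS.addr
  · simpa [withCtr] using hS.tmp
  · simpa [withCtr] using hS.aux
  · intro i
    simp [withCtr]
  · intro i hi
    simpa [withCtr, hi.not_gt] using hS.ctr_ge i (Nat.zero_le _)

/-- The characteristic string of a relation that can be tested in polynomial time can be computed
in polynomial time. -/
theorem PolyTest.tabulate {k : ℕ} {T : (n : ℕ) → (Fin k → Fin n) → (Arr → List Bool) → Prop}
    (h : PolyTest k T) :
    ∃ P : Prog (Stk Arr), ∃ p : Polynomial ℕ, ∀ n S, Ready n S → ∀ b, Does P b S true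
      (Function.update S new (FinCSP.encodeRel (fun x => T n x (tables S)) ++ S new))
      (p.eval n) := by
  obtain ⟨P, p, hP⟩ := h
  refine ⟨.seq (setFlag fun _ => true)
    (forTuples (.seq P (.seq (.push new fun r => r.1) (setFlag fun _ => true))) k),
    1 + forTuplesTime (p + 2) k, fun n S hS b => ?_⟩
  have h := does_forTuples (k := k) (n := n)
    (p := .seq P (.seq (.push new fun r => r.1) (setFlag fun _ => true))) (T := p + 2) (S := S)
    (fun x => T n x (tables S)) hS.size hS.tmp (fun i _ => hS.ctr_ge i (Nat.zero_le _))
    (fun x l => by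
      have h₁ := hP n x _ (hS.frame x l) true
      have e : tables (Function.update (withCtr S x) new l) = tables S := by
        funext a; simp [tables, withCtr]
      rw [e] at h₁
      have h₂ : Does (.push new fun r => r.1) (decide (T n x (tables S)))
          (Function.update (withCtr S x) new l) (decide (T n x (tables S)))
          (Function.update (withCtr S x) new (decide (T n x (tables S)) :: l)) 1 := by
        intro o
        have := Runs.push new (fun r => r.1) (decide (T n x (tables S)), o)
          (Function.update (withCtr S x) new l)
        exact ⟨o, 1, le_rfl, by simpa using this⟩
      exact Does.of (h₁.seq (h₂.seq (does_setFlag _))) rfl rfl (by simp))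
    (S new)
  rw [Function.update_eq_self] at h
  exact Does.of ((does_setFlag fun _ => true).seq h) rfl rfl (by simp)

/-- The word `W n s`, which depends on the size and the tables, can be prepended to the output in
polynomial time. -/
def Emits (W : ℕ → (Arr → List Bool) → List Bool) : Prop :=
  ∃ P : Prog (Stk Arr), ∃ p : Polynomial ℕ, ∀ n S, Ready n S → S new = [] → ∀ b, Does P b S true
    (Function.update S out (W n (tables S) ++ S out)) (p.eval n)

theorem PolyTest.emit {k : ℕ} {T : (n : ℕ) → (Fin k → Fin n) → (Arr → List Bool) → Prop}
    (h : PolyTest k T) : Emits fun n s => FinCSP.encodeRel fun x : Fin k → Fin n => T n x s := by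
  obtain ⟨P, p, hP⟩ := h.tabulate
  refine ⟨.seq P (.seq (move new tmp) (move tmp out)), p + 6 * Polynomial.X ^ k + 4,
    fun n S hS hn b => ?_⟩
  beta_reduce
  have h₁ := hP n S hS b
  have hlen := length_encodeRel (fun x => T n x (tables S))
  generalize FinCSP.encodeRel (fun x => T n x (tables S)) = l at *
  refine Does.of (h₁.seq ((does_move (by simp)).seq (does_move (by simp)))) rfl ?_ ?_
  · have := hS.tmp
    funext j
    by_cases h₁ : j = new <;> by_cases h₂ : j = tmp <;> by_cases h₃ : j = out <;> simp_all
  · simp [hn, hS.tmp, hlen]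
    omega

/-- The contents of a table can be replaced by the characteristic string of a testable relation. -/
theorem PolyTest.assign {k : ℕ} {T : (n : ℕ) → (Fin k → Fin n) → (Arr → List Bool) → Prop}
    (h : PolyTest k T) (a : Arr) :
    ∃ P : Prog (Stk Arr), ∃ p : Polynomial ℕ, ∀ n S, Ready n S → S new = [] →
      (S (arr a)).length ≤ n ^ k → ∀ b, Does P b S true
        (Function.update S (arr a) (FinCSP.encodeRel fun x => T n x (tables S))) (p.eval n) := by
  obtain ⟨P, p, hP⟩ := h.tabulate
  refine ⟨.seq P (.seq (clear (arr a)) (.seq (move new tmp) (move tmp (arr a)))),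
    p + 9 * Polynomial.X ^ k + 6, fun n S hS hn ha b => ?_⟩
  have h₁ := hP n S hS b
  have hlen := length_encodeRel (fun x => T n x (tables S))
  generalize FinCSP.encodeRel (fun x => T n x (tables S)) = l at *
  refine Does.of (h₁.seq ((does_clear (arr a)).seq
    ((does_move (by simp)).seq (does_move (by simp))))) rfl ?_ ?_
  · have := hS.tmp
    funext j
    by_cases h₁ : j = new <;> by_cases h₂ : j = tmp <;> by_cases h₃ : j = arr a <;> simp_all
  · simp [hn, hS.tmp, hlen]
    omega

theorem Ready.update_arr {n : ℕ} {S : Stk Arr → List Bool} (hS : Ready n S) (a : Arr)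
    (l : List Bool) : Ready n (Function.update S (arr a) l) where
  size := by simpa using hS.size
  addr := by simpa using hS.addr
  tmp := by simpa using hS.tmp
  aux := by simpa using hS.aux
  ctr_lt i := i.elim0
  ctr_ge i hi := by simpa using hS.ctr_ge i hi

theorem Ready.update_out {n : ℕ} {S : Stk Arr → List Bool} (hS : Ready n S) (l : List Bool) :
    Ready n (Function.update S out l) where
  size := by simpa using hS.size
  addr := by simpa using hS.addr
  tmp := by simpa using hS.tmp
  aux := by simpa using hS.aux
  ctr_lt i := i.elim0
  ctr_ge i hi := by simpa using hS.ctr_ge i hi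

/-- One round of the evaluation of a recursive definition of the table `a` by `T`. -/
noncomputable def stage {k : ℕ} (T : (n : ℕ) → (Fin k → Fin n) → (Arr → List Bool) → Prop) (a : Arr)
    (n : ℕ) (s : Arr → List Bool) : Arr → List Bool :=
  Function.update s a (FinCSP.encodeRel fun x : Fin k → Fin n => T n x s)

/-- The stacks `S` with the tables replaced by `s`. -/
def withTables (S : Stk Arr → List Bool) (s : Arr → List Bool) : Stk Arr → List Bool
  | arr a => s a
  | q => S q

theorem Ready.withTables {n : ℕ} {S : Stk Arr → List Bool} (hS : Ready n S)
    (s : Arr → List Bool) : Ready n (withTables S s) where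
  size := by simpa [StackProgram.withTables] using hS.size
  addr := by simpa [StackProgram.withTables] using hS.addr
  tmp := by simpa [StackProgram.withTables] using hS.tmp
  aux := by simpa [StackProgram.withTables] using hS.aux
  ctr_lt i := i.elim0
  ctr_ge i hi := by simpa [StackProgram.withTables] using hS.ctr_ge i hi

/-- A recursive definition of a table can be evaluated `n ^ m` times in polynomial time. -/
theorem PolyTest.iterate {k : ℕ} {T : (n : ℕ) → (Fin k → Fin n) → (Arr → List Bool) → Prop}
    (h : PolyTest k T) (a : Arr) (m : ℕ) :
    ∃ P : Prog (Stk Arr), ∃ p : Polynomial ℕ, ∀ n S, Ready n S → S new = [] → S iter = [] →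
      (S (arr a)).length ≤ n ^ k → ∀ b, Does P b S true
        (withTables S ((stage T a n)^[n ^ m] (tables S))) (p.eval n) := by
  obtain ⟨P, p, hP⟩ := h.assign a
  refine ⟨.seq (setFlag fun _ => true) (.seq (power m) (drain iter P)),
    powerTime m + (p + 2) * Polynomial.X ^ m + 3, fun n S hS hn hi ha b => ?_⟩
  have h₁ := does_power (b := true) m hS.size hS.tmp hS.aux hi
  have h₂ := does_drain (k := iter) (p := P) (T := p.eval n) (un (n ^ m)) (fun _ => true)
    (fun l => Function.update
      (withTables S ((stage T a n)^[n ^ m - l.length] (tables S))) iter l) (by simp)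
    (fun y l hl => by
      have hl' : l.length + 1 ≤ n ^ m := by simpa using hl.length_le
      obtain ⟨d, hd⟩ := Nat.exists_eq_add_of_le hl'
      have e₁ : n ^ m - l.length = d + 1 := by omega
      have e₂ : n ^ m - (y :: l).length = d := by
        rw [List.length_cons]; omega
      rw [e₁, e₂, Function.iterate_succ_apply']
      have hlen : ((stage T a n)^[d] (tables S) a).length ≤ n ^ k := by
        cases d with
        | zero => simpa [tables] using ha
        | succ d =>
          rw [Function.iterate_succ_apply']
          simp [stage, length_encodeRel]
      generalize (stage T a n)^[d] (tables S) = s at *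
      have hR : Ready n (Function.update (withTables S s) iter l) := by
        constructor
        · simpa using (hS.withTables s).size
        · simpa using (hS.withTables s).addr
        · simpa using (hS.withTables s).tmp
        · simpa using (hS.withTables s).aux
        · exact fun i => i.elim0
        · exact fun i hi => by simpa using (hS.withTables s).ctr_ge i hi
      have h := hP n _ hR (by simpa [withTables] using hn) (by simpa [withTables] using hlen) true
      have e : tables (Function.update (withTables S s) iter l) = s := by
        funext a; simp [tables, withTables]
      rw [e] at h
      simp only [Function.update_idem]
      refine DoesAt.of (h _) rfl ?_ le_rfl
      funext j
      cases j with
      | arr c =>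
        by_cases hc : c = a
        · subst hc; simp [withTables, stage]
        · simp [withTables, stage, hc]
      | iter => simp
      | _ => simp [withTables])
  have e₀ : Function.update (withTables S ((stage T a n)^[n ^ m - (un (n ^ m)).length] (tables S)))
      iter (un (n ^ m)) = Function.update S iter (un (n ^ m)) := by
    funext j
    cases j <;> simp [withTables, tables]
  have e₁ : ∀ s, Function.update (withTables S s) iter [] = withTables S s := by
    intro s
    rw [Function.update_eq_self_iff]
    simp [withTables, hi]
  rw [e₀, e₁] at h₂
  refine Does.of ((does_setFlag fun _ => true).seq (h₁.seq h₂)) rfl (by simp) ?_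
  simp
  omega

end Loops

end StackProgram

/-! ### Term operations and relations defined by conjunctions of atoms -/

namespace FinCSP

open FirstOrder.Language FirstOrder.Language.Structure

section Translation

variable {L : FirstOrder.Language.{u, v}} {L' : FirstOrder.Language.{u', v'}}

/-- Every basic operation of one structure is a term operation of the other. A dummy last variable
makes this true of constants as well, terms without variables not being available. -/
theorem exists_term_of_clone_eq {A : Type w} [L.Structure A] [L'.Structure A]
    (h : clone L A = clone L' A) {k : ℕ} (g : L'.Functions k) :
    ∃ t : L.Term (Fin (k + 1)), ∀ x : Fin (k + 1) → A, t.realize x = funMap g (Fin.init x) := by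
  have hg : (⟨k + 1, fun x => funMap g (Fin.init x)⟩ : Σ n : ℕ, (Fin n → A) → A) ∈ clone L' A :=
    ⟨k.succ_pos, .func g fun i => .var i.castSucc, fun x => rfl⟩
  rw [← h] at hg
  exact hg.2

/-- If the partial polymorphisms of the second structure preserve the relations of the first, then
every nonempty relation of the first structure is defined by the equalities and the atomic formulas
of the second structure that it satisfies. Otherwise let `s` be a further solution of these
conditions: sending the column `j` of the matrix whose rows are the tuples in `R` to `s j` is then a
well-defined partial polymorphism of the second structure that does not preserve `R`. -/
theorem relMap_of_partialPolymorphisms_eq {A : Type w} [Finite A] [L.Structure A] [L'.Structure A]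
    (h : partialPolymorphisms L A = partialPolymorphisms L' A) {k : ℕ} (R : L.Relations k)
    (hR : ∃ t : Fin k → A, RelMap R t) (s : Fin k → A)
    (heq : ∀ i j, (∀ t : Fin k → A, RelMap R t → t i = t j) → s i = s j)
    (hatom : ∀ (m : ℕ) (Q : L'.Relations m) (ι : Fin m → Fin k),
      (∀ t : Fin k → A, RelMap R t → RelMap Q (t ∘ ι)) → RelMap Q (s ∘ ι)) :
    RelMap R s := by
  classical
  obtain ⟨t₀, ht₀⟩ := hR
  let e := Finite.equivFin {t : Fin k → A // RelMap R t}
  set n := Nat.card {t : Fin k → A // RelMap R t}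
  have hn : 0 < n := Fin.pos (e ⟨t₀, ht₀⟩)
  let T : Fin n → Fin k → A := fun i => (e.symm i).1
  have hT : ∀ i, RelMap R (T i) := fun i => (e.symm i).2
  have hT' : ∀ t : Fin k → A, RelMap R t → ∃ i, T i = t := fun t ht =>
    ⟨e ⟨t, ht⟩, by simp [T]⟩
  let h₀ : (Fin n → A) →. A := fun c => ⟨∃ j, c = fun i => T i j, fun hj => s hj.choose⟩
  have hcol : ∀ j y, y ∈ h₀ (fun i => T i j) → y = s j := by
    rintro j y ⟨hj, rfl⟩
    refine heq _ _ fun t ht => ?_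
    obtain ⟨i, rfl⟩ := hT' t ht
    exact (congrFun hj.choose_spec i).symm
  have hcol' : ∀ j, s j ∈ h₀ (fun i => T i j) := by
    intro j
    have hd : (h₀ fun i => T i j).Dom := ⟨j, rfl⟩
    have := hcol j _ (Part.get_mem hd)
    rw [← this]
    exact Part.get_mem hd
  have hmem : (⟨n, h₀⟩ : Σ n : ℕ, (Fin n → A) →. A) ∈ partialPolymorphisms L' A := by
    refine ⟨hn, fun m Q r hr q hq => ?_⟩
    have hdom : ∀ j, ∃ j', (fun i => r i j) = fun i => T i j' := fun j => (hq j).1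
    choose ι hι using hdom
    have hr' : ∀ i, r i = T i ∘ ι := fun i => funext fun j => congrFun (hι j) i
    have hq' : q = s ∘ ι := by
      funext j
      have := hq j
      rw [hι j] at this
      exact hcol _ _ this
    rw [hq']
    refine hatom m Q ι fun t ht => ?_
    obtain ⟨i, rfl⟩ := hT' t ht
    rw [← hr' i]
    exact hr i
  rw [← h] at hmem
  exact hmem.2 k R T hT s hcol'

/-- A translation of the operation symbols of `L'` into terms of `L`, with a dummy last variable. -/
abbrev TermMap (L : FirstOrder.Language.{u, v}) (L' : FirstOrder.Language.{u', v'}) :=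
  ∀ k, L'.Functions k → L.Term (Fin (k + 1))

/-- The translation of terms induced by a translation of operation symbols. The dummy variables are
replaced by the variable `d`. -/
def translate (τ : TermMap L L') {m : ℕ} (d : Fin m) : L'.Term (Fin m) → L.Term (Fin m)
  | .var i => .var i
  | .func (l := l) g us => (τ l g).subst
      (Fin.snoc (α := fun _ => L.Term (Fin m)) (fun i => translate τ d (us i)) (.var d))

theorem realize_translate_func (τ : TermMap L L') {m l : ℕ} (d : Fin m) (g : L'.Functions l)
    (us : Fin l → L'.Term (Fin m)) {X : Type*} [L.Structure X] (x : Fin m → X) :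
    (translate τ d (.func g us)).realize x = (τ l g).realize
      (Fin.snoc (α := fun _ => X) (fun i => (translate τ d (us i)).realize x) (x d)) := by
  rw [translate, Term.realize_subst]
  congr 1
  funext i
  refine Fin.lastCases ?_ (fun j => ?_) i <;> simp

theorem realize_translate {A : Type w} [L.Structure A] [L'.Structure A] {τ : TermMap L L'}
    (hτ : ∀ k (g : L'.Functions k) (x : Fin (k + 1) → A),
      (τ k g).realize x = funMap g (Fin.init x))
    {m : ℕ} (d : Fin m) (t : L'.Term (Fin m)) (x : Fin m → A) :
    (translate τ d t).realize x = t.realize x := by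
  induction t with
  | var i => rfl
  | func g us ih =>
    rw [realize_translate_func, hτ, Fin.init_snoc]
    simp [ih]

end Translation

section Congruence

variable {L : FirstOrder.Language.{u, v}} {L' : FirstOrder.Language.{u', v'}}

/-- One round of the generation of the congruence on the `L`-structure `X` that makes the operations
of `L` and `L'` interdefinable by the translations `τ` and `τ'` and forces the equalities that hold
in the relations of `A`. -/
def closureStep (τ : TermMap L L') (τ' : TermMap L' L) (A : Type w) [L.Structure A] {X : Type*}
    [L.Structure X] (E : X → X → Prop) (x y : X) : Prop :=
  E x y ∨ x = y ∨ E y x ∨ (∃ z, E x z ∧ E z y) ∨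
  (∃ f : Σ k, L.Functions k, ∃ a b : Fin f.1 → X,
    (∀ i, E (a i) (b i)) ∧ funMap f.2 a = x ∧ funMap f.2 b = y) ∨
  (∃ f : Σ k, L.Functions k, ∃ a : Fin (f.1 + 1) → X,
    funMap f.2 (Fin.init a) = x ∧
      (translate τ (Fin.last f.1) (τ' f.1 f.2)).realize a = y) ∨
  (∃ g : Σ k, L'.Functions k, ∃ a b : Fin (g.1 + 1) → X, Fin.init a = Fin.init b ∧
    (τ g.1 g.2).realize a = x ∧ (τ g.1 g.2).realize b = y) ∨
  (∃ R : Σ k, L.Relations k, ∃ i j : Fin R.1,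
    (∀ t : Fin R.1 → A, RelMap R.2 t → t i = t j) ∧
      ∃ a : Fin R.1 → X, RelMap R.2 a ∧ a i = x ∧ a j = y)

theorem realize_congr_of_closed {τ : TermMap L L'} {τ' : TermMap L' L} {A : Type w}
    [L.Structure A] {X : Type*} [L.Structure X] {E : X → X → Prop}
    (hE : ∀ x y, closureStep τ τ' A E x y → E x y)
    {α : Type*} (t : L.Term α) {x y : α → X} (hxy : ∀ i, E (x i) (y i)) :
    E (t.realize x) (t.realize y) := by
  induction t with
  | var i => exact hxy i
  | func f us ih =>
    exact hE _ _ (.inr <| .inr <| .inr <| .inr <| .inl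
      ⟨⟨_, f⟩, fun i => (us i).realize x, fun i => (us i).realize y, ih, rfl, rfl⟩)

variable {τ : TermMap L L'} {τ' : TermMap L' L} {A : Type w} [L.Structure A] [L'.Structure A]
  {X : Type*} [L.Structure X] {E : X → X → Prop}

/-- Homomorphisms to `A` identify the elements that are related. -/
theorem closureStep_sound
    (hτ : ∀ k (g : L'.Functions k) (x : Fin (k + 1) → A),
      (τ k g).realize x = funMap g (Fin.init x))
    (hτ' : ∀ k (f : L.Functions k) (x : Fin (k + 1) → A),
      (τ' k f).realize x = funMap f (Fin.init x))
    (φ : X →[L] A) (hE : ∀ x y, E x y → φ x = φ y) (x y : X)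
    (h : closureStep τ τ' A E x y) : φ x = φ y := by
  rcases h with h | rfl | h | ⟨z, h₁, h₂⟩ | ⟨f, a, b, hab, rfl, rfl⟩ | ⟨f, a, rfl, rfl⟩ |
    ⟨g, a, b, hab, rfl, rfl⟩ | ⟨R, i, j, hR, a, ha, rfl, rfl⟩
  · exact hE _ _ h
  · rfl
  · exact (hE _ _ h).symm
  · exact (hE _ _ h₁).trans (hE _ _ h₂)
  · rw [Hom.map_fun, Hom.map_fun]
    congr 1
    funext i
    exact hE _ _ (hab i)
  · rw [← HomClass.realize_term, realize_translate hτ, hτ', Hom.map_fun]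
    rfl
  · rw [← HomClass.realize_term, ← HomClass.realize_term, hτ, hτ]
    congr 1
    funext i
    exact congrArg φ (congrFun hab i)
  · exact hR (φ ∘ a) (Hom.map_rel φ _ _ ha)

/-- The `L'`-structure on `X` that corresponds to the quotient of `X` by the congruence `E`; the
function `rep` chooses representatives of the classes. No element is removed: those that are not
representatives are no values of operations, and can be mapped like their representatives. -/
@[reducible] def quotientStructure (L : FirstOrder.Language.{u, v})
    (L' : FirstOrder.Language.{u', v'}) (τ : TermMap L L') (A : Type w) [L.Structure A]
    [L'.Structure A] {X : Type*} [L.Structure X] (E : X → X → Prop) (rep : X → X) (d : X) :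
    L'.Structure X where
  funMap {k} g a := rep ((τ k g).realize (Fin.snoc (α := fun _ => X) a d))
  RelMap {m} Q y := ∃ R : Σ k, L.Relations k, ∃ ι : Fin m → Fin R.1,
    (∀ t : Fin R.1 → A, RelMap R.2 t → RelMap Q (t ∘ ι)) ∧
      ∃ a : Fin R.1 → X, RelMap R.2 a ∧ ∀ j, E (y j) (a (ι j))

/-- The reduction is correct: the `L`-structure `X` and the corresponding `L'`-structure admit
homomorphisms to `A` simultaneously. -/
theorem nonempty_hom_iff [Finite A]
    (hpartial : partialPolymorphisms L A = partialPolymorphisms L' A)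
    (hτ : ∀ k (g : L'.Functions k) (x : Fin (k + 1) → A),
      (τ k g).realize x = funMap g (Fin.init x))
    (hτ' : ∀ k (f : L.Functions k) (x : Fin (k + 1) → A),
      (τ' k f).realize x = funMap f (Fin.init x))
    (hE : ∀ x y, closureStep τ τ' A E x y → E x y)
    (hsound : ∀ φ : X →[L] A, ∀ x y, E x y → φ x = φ y)
    (hne : ∀ k (R : L.Relations k), (∃ a : Fin k → X, RelMap R a) → ∃ t : Fin k → A, RelMap R t)
    (rep : X → X) (hrep : ∀ x, E x (rep x)) (hrep' : ∀ x y, E x y → rep x = rep y) (d : X) :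
    Nonempty (X →[L] A) ↔
      (letI := quotientStructure L L' τ A E rep d; Nonempty (X →[L'] A)) := by
  let Y := quotientStructure L L' τ A E rep d
  have hrefl : ∀ x, E x x := fun x => hE _ _ (.inr <| .inl rfl)
  have hsymm : ∀ {x y}, E x y → E y x := fun h => hE _ _ (.inr <| .inr <| .inl h)
  have htrans : ∀ {x y z}, E x y → E y z → E x z := fun h h' =>
    hE _ _ (.inr <| .inr <| .inr <| .inl ⟨_, h, h'⟩)
  constructor
  · rintro ⟨φ⟩
    refine ⟨⟨φ, fun {k} g a => ?_, fun {m} Q y hy => ?_⟩⟩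
    · change φ (rep _) = _
      rw [← hsound φ _ _ (hrep _), ← HomClass.realize_term, hτ]
      congr 1
      funext i
      simp [Fin.init]
    · obtain ⟨R, ι, hR, a, ha, hy⟩ := hy
      have := hR (φ ∘ a) (Hom.map_rel φ _ _ ha)
      convert this using 1
      funext j
      exact hsound φ _ _ (hy j)
  · rintro ⟨ψ⟩
    -- `rep` turns the translations of terms of `L'` into the terms themselves; the dummy arguments,
    -- which are `x e` on the left and `d` on the right, do not matter up to `E`
    have key : ∀ {m : ℕ} (e : Fin m) (t : L'.Term (Fin m)) (x : Fin m → X),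
        rep ((translate τ e t).realize x) = t.realize fun i => rep (x i) := by
      intro m e t x
      induction t with
      | var i => rfl
      | @func l g us ih =>
        rw [realize_translate_func]
        change _ = rep ((τ l g).realize (Fin.snoc (α := fun _ => X) (fun i => (us i).realize _) d))
        simp only [← ih]
        refine hrep' _ _ (htrans (realize_congr_of_closed hE _
          (y := Fin.snoc (α := fun _ => X) (fun i => rep ((translate τ e (us i)).realize x)) (x e))
          fun i => ?_) (hE _ _ (.inr <| .inr <| .inr <| .inr <| .inr <| .inr <| .inl
            ⟨⟨l, g⟩, _, _, ?_, rfl, rfl⟩)))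
        · refine Fin.lastCases ?_ (fun j => ?_) i
          · simpa using hrefl _
          · simpa using hrep _
        · simp
    refine ⟨⟨fun x => ψ (rep x), fun {k} f a => ?_, fun {k} R a ha => ?_⟩⟩
    · have h₁ : rep (funMap f a) = rep ((translate τ (Fin.last k) (τ' k f)).realize
          (Fin.snoc (α := fun _ => X) a d)) :=
        hrep' _ _ (hE _ _ (.inr <| .inr <| .inr <| .inr <| .inr <| .inl
          ⟨⟨k, f⟩, Fin.snoc (α := fun _ => X) a d, by simp, rfl⟩))
      rw [h₁, key, ← HomClass.realize_term, hτ']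
      congr 1
      funext i
      simp [Fin.init]
    · refine relMap_of_partialPolymorphisms_eq hpartial R (hne k R ⟨a, ha⟩) _ (fun i j hij => ?_)
        fun m Q ι hQ => ?_
      · have : rep (a i) = rep (a j) :=
          hrep' _ _ (hE _ _ (.inr <| .inr <| .inr <| .inr <| .inr <| .inr <| .inr
            ⟨⟨k, R⟩, i, j, hij, a, ha, rfl, rfl⟩))
        exact congrArg ψ this
      · have : RelMap Q fun j => rep (a (ι j)) :=
          ⟨⟨k, R⟩, ι, hQ, a, ha, fun j => hsymm (hrep _)⟩
        exact Hom.map_rel ψ _ _ this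

end Congruence

end FinCSP

/-! ### First-order description of the reduction -/

namespace FinCSP

open FirstOrder.Language FirstOrder.Language.Structure StackProgram

/-- The tables used by the reduction: one for the graph of each operation and one for each relation
of the given structure, and one for the congruence. -/
inductive Tab (L : FirstOrder.Language.{u, v}) : Type (max u v)
  | fn (f : Σ k, L.Functions k)
  | rl (R : Σ k, L.Relations k)
  | cong

section Tests

variable {L : FirstOrder.Language.{u, v}} {n : ℕ}

/-- The table of the congruence relates `x` and `y`. -/
abbrev Cong (s : Tab L → List Bool) (x y : Fin n) : Prop := Holds s .cong ![x, y]

/-- The term `t` takes the value `z` at `x`, as far as the tables of the operations say so. -/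
def TermHolds (s : Tab L → List Bool) {m : ℕ} : L.Term (Fin m) → (Fin m → Fin n) → Fin n → Prop
  | .var i, x, z => x i = z
  | .func (l := l) f us, x, z =>
      ∃ y : Fin l → Fin n, (∀ i, TermHolds s (us i) x (y i)) ∧ Holds s (.fn ⟨l, f⟩) (Fin.snoc y z :
        Fin (l + 1) → Fin n)

/-- The tables `s` describe the operations and relations of the structure `X`. -/
structure Represents (X : L.Structure (Fin n)) (s : Tab L → List Bool) : Prop where
  fn : ∀ (f : Σ k, L.Functions k) (x : Fin (f.1 + 1) → Fin n),
    Holds s (.fn f) x ↔ X.funMap f.2 (Fin.init x) = x (Fin.last f.1)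
  rl : ∀ (R : Σ k, L.Relations k) (x : Fin R.1 → Fin n), Holds s (.rl R) x ↔ X.RelMap R.2 x

theorem Represents.termHolds {X : L.Structure (Fin n)} {s : Tab L → List Bool}
    (h : Represents X s) {m : ℕ} (t : L.Term (Fin m)) (x : Fin m → Fin n) (z : Fin n) :
    TermHolds s t x z ↔ t.realize x = z := by
  induction t generalizing z with
  | var i => rfl
  | @func l f us ih =>
    simp only [TermHolds, ih, h.fn, Fin.init_snoc, Fin.snoc_last]
    constructor
    · rintro ⟨y, hy, rfl⟩
      obtain rfl : (fun i => (us i).realize x) = y := funext hy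
      rfl
    · rintro rfl
      exact ⟨_, fun i => rfl, rfl⟩

theorem polyTest_graph {ℓ : ℕ} (f : Σ k, L.Functions k) (σ : Fin f.1 → Fin ℓ) (j : Fin ℓ) :
    PolyTest ℓ fun n x s =>
      Holds s (Tab.fn f) (Fin.snoc (fun i => x (σ i)) (x j) : Fin (f.1 + 1) → Fin n) :=
  (PolyTest.holds (Tab.fn f) (Fin.snoc σ j : Fin (f.1 + 1) → Fin ℓ)).congr fun n x s => by
    have : (fun i => x ((Fin.snoc σ j : Fin (f.1 + 1) → Fin ℓ) i)) =
        (Fin.snoc (fun i => x (σ i)) (x j) : Fin (f.1 + 1) → Fin n) :=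
      Fin.comp_snoc x σ j
    rw [this]

theorem polyTest_cong {ℓ : ℕ} (i j : Fin ℓ) :
    PolyTest (Arr := Tab L) ℓ fun _ x s => Cong s (x i) (x j) :=
  (PolyTest.holds Tab.cong ![i, j]).congr fun n x s => by
    have : (fun k => x (![i, j] k)) = ![x i, x j] := by
      funext k; fin_cases k <;> rfl
    rw [this]

theorem polyTest_term {m : ℕ} (t : L.Term (Fin m)) {ℓ : ℕ} (σ : Fin m → Fin ℓ) (ζ : Fin ℓ) :
    PolyTest ℓ fun _ x s => TermHolds s t (fun i => x (σ i)) (x ζ) := by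
  induction t generalizing ℓ with
  | var i => exact PolyTest.eq (σ i) ζ
  | @func l f us ih =>
    refine (PolyTest.exists_tuple l
      ((PolyTest.forall_finite fun i => ih i (fun j => Fin.castAdd l (σ j)) (Fin.natAdd ℓ i)).and
        (polyTest_graph ⟨l, f⟩ (fun i => Fin.natAdd ℓ i) (Fin.castAdd l ζ)))).congr
      fun n x s => ?_
    simp [TermHolds]

/-- `closureStep`, expressed by the tables. -/
def closureTest {L' : FirstOrder.Language.{u', v'}} (τ : TermMap L L') (τ' : TermMap L' L)
    (A : Type w) [L.Structure A] (s : Tab L → List Bool) (x y : Fin n) : Prop :=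
  Cong s x y ∨ x = y ∨ Cong s y x ∨ (∃ z, Cong s x z ∧ Cong s z y) ∨
  (∃ f : Σ k, L.Functions k, ∃ a b : Fin f.1 → Fin n, (∀ i, Cong s (a i) (b i)) ∧
    Holds s (.fn f) (Fin.snoc a x : Fin (f.1 + 1) → Fin n) ∧
      Holds s (.fn f) (Fin.snoc b y : Fin (f.1 + 1) → Fin n)) ∨
  (∃ f : Σ k, L.Functions k, ∃ a : Fin (f.1 + 1) → Fin n,
    Holds s (.fn f) (Fin.snoc (Fin.init a) x : Fin (f.1 + 1) → Fin n) ∧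
      TermHolds s (translate τ (Fin.last f.1) (τ' f.1 f.2)) a y) ∨
  (∃ g : Σ k, L'.Functions k, ∃ a b : Fin (g.1 + 1) → Fin n,
    (∀ i : Fin g.1, a i.castSucc = b i.castSucc) ∧
    TermHolds s (τ g.1 g.2) a x ∧ TermHolds s (τ g.1 g.2) b y) ∨
  (∃ R : Σ k, L.Relations k, ∃ i j : Fin R.1,
    (∀ t : Fin R.1 → A, RelMap R.2 t → t i = t j) ∧
      ∃ a : Fin R.1 → Fin n, Holds s (.rl R) a ∧ a i = x ∧ a j = y)

theorem Represents.closureTest_iff {L' : FirstOrder.Language.{u', v'}} {τ : TermMap L L'}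
    {τ' : TermMap L' L} {A : Type w} [L.Structure A] {X : L.Structure (Fin n)}
    {s : Tab L → List Bool} (h : Represents X s) (x y : Fin n) :
    closureTest τ τ' A s x y ↔ closureStep τ τ' A (Cong s) x y := by
  simp only [closureTest, closureStep, h.fn, h.rl, h.termHolds, Fin.init_snoc, Fin.snoc_last,
    funext_iff, Fin.init]

theorem polyTest_closureTest [Finite (Σ k, L.Functions k)] [Finite (Σ k, L.Relations k)]
    {L' : FirstOrder.Language.{u', v'}} [Finite (Σ k, L'.Functions k)] (τ : TermMap L L')
    (τ' : TermMap L' L) (A : Type w) [L.Structure A] :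
    PolyTest (Arr := Tab L) 2 fun _ x s => closureTest τ τ' A s (x 0) (x 1) := by
  refine (polyTest_cong 0 1).or <| (PolyTest.eq 0 1).or <| (polyTest_cong 1 0).or <|
    PolyTest.or ?_ <| PolyTest.or ?_ <| PolyTest.or ?_ <| PolyTest.or ?_ ?_
  · exact (PolyTest.exists ((polyTest_cong (0 : Fin 2).castSucc (Fin.last 2)).and
      (polyTest_cong (Fin.last 2) (1 : Fin 2).castSucc))).congr fun n x s => by
        simp only [Fin.snoc_castSucc, Fin.snoc_last]
  · refine PolyTest.exists_finite fun f => ?_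
    refine (PolyTest.exists_tuple f.1 <| PolyTest.exists_tuple f.1 <|
      (PolyTest.forall_finite fun i : Fin f.1 =>
        polyTest_cong (Fin.castAdd f.1 (Fin.natAdd 2 i)) (Fin.natAdd (2 + f.1) i)).and <|
      (polyTest_graph f (fun i => Fin.castAdd f.1 (Fin.natAdd 2 i))
        (Fin.castAdd f.1 (Fin.castAdd f.1 0))).and
      (polyTest_graph f (fun i => Fin.natAdd (2 + f.1) i)
        (Fin.castAdd f.1 (Fin.castAdd f.1 1)))).congr fun n x s => ?_
    simp only [Fin.append_left, Fin.append_right]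
  · refine PolyTest.exists_finite fun f => ?_
    refine (PolyTest.exists_tuple (f.1 + 1) <|
      (polyTest_graph f (fun i => Fin.natAdd 2 i.castSucc) (Fin.castAdd (f.1 + 1) 0)).and
      (polyTest_term (translate τ (Fin.last f.1) (τ' f.1 f.2)) (fun i => Fin.natAdd 2 i)
        (Fin.castAdd (f.1 + 1) 1))).congr fun n x s => ?_
    simp only [Fin.append_left, Fin.append_right]
    rfl
  · refine PolyTest.exists_finite fun g => ?_
    refine (PolyTest.exists_tuple (g.1 + 1) <| PolyTest.exists_tuple (g.1 + 1) <|
      (PolyTest.forall_finite fun i : Fin g.1 =>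
        PolyTest.eq (Fin.castAdd (g.1 + 1) (Fin.natAdd 2 i.castSucc))
          (Fin.natAdd (2 + (g.1 + 1)) i.castSucc)).and <|
      (polyTest_term (τ g.1 g.2) (fun i => Fin.castAdd (g.1 + 1) (Fin.natAdd 2 i))
        (Fin.castAdd (g.1 + 1) (Fin.castAdd (g.1 + 1) 0))).and
      (polyTest_term (τ g.1 g.2) (fun i => Fin.natAdd (2 + (g.1 + 1)) i)
        (Fin.castAdd (g.1 + 1) (Fin.castAdd (g.1 + 1) 1)))).congr fun n x s => ?_
    simp only [Fin.append_left, Fin.append_right]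
  · refine PolyTest.exists_finite fun R => PolyTest.exists_finite fun i =>
      PolyTest.exists_finite fun j => (PolyTest.const 2 _).and ?_
    refine (PolyTest.exists_tuple R.1 <|
      (PolyTest.holds (Tab.rl R) fun i => Fin.natAdd 2 i).and <|
      (PolyTest.eq (Fin.natAdd 2 i) (Fin.castAdd R.1 0)).and
      (PolyTest.eq (Fin.natAdd 2 j) (Fin.castAdd R.1 1))).congr fun n x s => ?_
    simp only [Fin.append_left, Fin.append_right]

/-- `v` is the least element related to `x`. -/
def IsRep (s : Tab L → List Bool) (x v : Fin n) : Prop :=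
  Cong s x v ∧ ∀ y, Cong s x y → v ≤ y

/-- The graph of the operation `g` of the output, expressed by the tables. -/
def outputFn {L' : FirstOrder.Language.{u', v'}} (τ : TermMap L L') (g : Σ k, L'.Functions k)
    (s : Tab L → List Bool) (x : Fin (g.1 + 1) → Fin n) : Prop :=
  ∃ d z : Fin n, TermHolds s (τ g.1 g.2) (Fin.snoc (α := fun _ => Fin n) (Fin.init x) d) z ∧
    IsRep s z (x (Fin.last g.1))

/-- The relation `Q` of the output, expressed by the tables. -/
def outputRl {L' : FirstOrder.Language.{u', v'}} (A : Type w) [L.Structure A] [L'.Structure A]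
    (Q : Σ k, L'.Relations k) (s : Tab L → List Bool) (y : Fin Q.1 → Fin n) : Prop :=
  ∃ R : Σ k, L.Relations k, ∃ ι : Fin Q.1 → Fin R.1,
    (∀ t : Fin R.1 → A, RelMap R.2 t → RelMap Q.2 (t ∘ ι)) ∧
      ∃ a : Fin R.1 → Fin n, Holds s (.rl R) a ∧ ∀ j, Cong s (y j) (a (ι j))

/-- The tables describe a structure no relation of which is nonempty while the corresponding
relation of `A` is empty. The last condition is necessary for a homomorphism to `A`. It is tested
separately because an empty relation of `A` need not be defined by equalities and atoms. -/
def Valid (A : Type w) [L.Structure A] (n : ℕ) (s : Tab L → List Bool) : Prop :=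
  (∀ f : Σ k, L.Functions k, ∀ a : Fin f.1 → Fin n, ∃ z,
    Holds s (.fn f) (Fin.snoc a z : Fin (f.1 + 1) → Fin n) ∧
      ∀ z', Holds s (.fn f) (Fin.snoc a z' : Fin (f.1 + 1) → Fin n) → z' = z) ∧
  ∀ R : Σ k, L.Relations k, (∃ t : Fin R.1 → A, RelMap R.2 t) ∨
    ¬ ∃ a : Fin R.1 → Fin n, Holds s (.rl R) a

theorem polyTest_valid [Finite (Σ k, L.Functions k)] [Finite (Σ k, L.Relations k)]
    (A : Type w) [L.Structure A] :
    PolyTest (Arr := Tab L) 0 fun n _ s => Valid A n s := by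
  refine (PolyTest.forall_finite fun f => ?_).and
    (PolyTest.forall_finite fun R => (PolyTest.const 0 _).or (PolyTest.not ?_))
  · refine (PolyTest.forall_tuple f.1 <| PolyTest.exists <|
      (polyTest_graph f (fun i => (Fin.natAdd 0 i).castSucc) (Fin.last _)).and <|
      PolyTest.forall <|
      (((polyTest_graph f (fun i => (Fin.natAdd 0 i).castSucc.castSucc) (Fin.last _)).not).or
      (PolyTest.eq (Fin.last _) (Fin.last _).castSucc))).congr fun n x s => ?_
    simp only [Fin.snoc_castSucc, Fin.snoc_last, Fin.append_right, imp_iff_not_or]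
  · refine (PolyTest.exists_tuple R.1 <|
      PolyTest.holds (Tab.rl R) fun i => Fin.natAdd 0 i).congr fun n x s => ?_
    simp only [Fin.append_right]

theorem polyTest_outputFn {L' : FirstOrder.Language.{u', v'}} (τ : TermMap L L')
    (g : Σ k, L'.Functions k) :
    PolyTest (Arr := Tab L) (g.1 + 1) fun _ x s => outputFn τ g s x := by
  refine (PolyTest.exists <| PolyTest.exists <|
    (polyTest_term (τ g.1 g.2) (Fin.snoc (α := fun _ => Fin (g.1 + 1 + 1 + 1))
      (fun i => i.castSucc.castSucc.castSucc) (Fin.last _).castSucc) (Fin.last _)).and <|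
    (polyTest_cong (Fin.last _) (Fin.last g.1).castSucc.castSucc).and <|
    PolyTest.forall <| ((polyTest_cong (Fin.last _).castSucc (Fin.last _)).not).or
      (PolyTest.le (Fin.last g.1).castSucc.castSucc.castSucc (Fin.last _))).congr fun n x s => ?_
  have e : ∀ d z : Fin n, (fun i => (Fin.snoc (Fin.snoc x d : Fin (g.1 + 1 + 1) → Fin n) z :
      Fin (g.1 + 1 + 1 + 1) → Fin n) ((Fin.snoc (α := fun _ => Fin (g.1 + 1 + 1 + 1))
      (fun i => i.castSucc.castSucc.castSucc) (Fin.last _).castSucc : Fin (g.1 + 1) → _) i)) =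
      Fin.snoc (α := fun _ => Fin n) (Fin.init x) d := by
    intro d z
    funext i
    refine Fin.lastCases ?_ (fun j => ?_) i
    · simp only [Fin.snoc_castSucc, Fin.snoc_last]
    · simp only [Fin.snoc_castSucc, Fin.init]
  simp only [e, Fin.snoc_castSucc, Fin.snoc_last, outputFn, IsRep, imp_iff_not_or]

theorem polyTest_outputRl [Finite (Σ k, L.Relations k)] {L' : FirstOrder.Language.{u', v'}}
    (A : Type w) [L.Structure A] [L'.Structure A] (Q : Σ k, L'.Relations k) :
    PolyTest (Arr := Tab L) Q.1 fun _ y s => outputRl A Q s y := by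
  refine PolyTest.exists_finite fun R => PolyTest.exists_finite fun ι =>
    (PolyTest.const _ _).and ?_
  refine (PolyTest.exists_tuple R.1 <|
    (PolyTest.holds (Tab.rl R) fun i => Fin.natAdd Q.1 i).and <|
    PolyTest.forall_finite fun j : Fin Q.1 =>
      polyTest_cong (Fin.castAdd R.1 j) (Fin.natAdd Q.1 (ι j))).congr fun n x s => ?_
  simp only [Fin.append_left, Fin.append_right]

end Tests

end FinCSP

/-! ### Generation of the congruence and correctness of the output -/

namespace FinCSP

open FirstOrder.Language FirstOrder.Language.Structure StackProgram

/-- An inflationary operator on the subsets of a set with at most `N` elements becomes stationary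
after `N` rounds. -/
theorem iterate_fixed_of_card_le {α : Type*} [Finite α] (f : Set α → Set α) (hf : ∀ s, s ⊆ f s)
    (s : Set α) {N : ℕ} (hN : Nat.card α ≤ N) : f (f^[N] s) = f^[N] s := by
  have key : ∀ j, f (f^[j] s) = f^[j] s ∨ j ≤ (f^[j] s).ncard := by
    intro j
    induction j with
    | zero => exact .inr (Nat.zero_le _)
    | succ j ih =>
      rw [Function.iterate_succ_apply']
      by_cases h : f (f^[j] s) = f^[j] s
      · left; rw [h, h]
      · right
        have h₁ := ih.resolve_left h
        have h₂ : (f^[j] s).ncard < (f (f^[j] s)).ncard :=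
          Set.ncard_lt_ncard ((hf _).ssubset_of_ne (Ne.symm h)) (Set.toFinite _)
        omega
  rcases key N with h | h
  · exact h
  · have h₁ : f^[N] s = Set.univ := by
      refine Set.eq_of_subset_of_ncard_le (Set.subset_univ _) ?_ (Set.toFinite _)
      rw [Set.ncard_univ]
      exact hN.trans h
    rw [h₁]
    exact Set.univ_subset_iff.1 (hf _)

theorem holds_iff_of_eq_encodeRel {Arr : Type u} {s : Arr → List Bool} {a : Arr} {n k : ℕ}
    {R : (Fin k → Fin n) → Prop} (h : s a = encodeRel R) (x : Fin k → Fin n) :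
    Holds s a x ↔ R x := by
  rw [Holds, h, encodeRel, List.getD_eq_getElem _ _ (by
    rw [List.length_ofFn]; exact (finFunctionFinEquiv x).isLt), List.getElem_ofFn]
  simp only [Fin.eta, Equiv.symm_apply_apply, decide_eq_true_eq]

theorem eq_encodeRel_of_holds_iff {Arr : Type u} {s : Arr → List Bool} {a : Arr} {n k : ℕ}
    {R : (Fin k → Fin n) → Prop} (hlen : (s a).length = n ^ k)
    (h : ∀ x : Fin k → Fin n, Holds s a x ↔ R x) : s a = encodeRel R := by
  refine List.ext_getElem (by simp [hlen, encodeRel]) fun i h₁ h₂ => ?_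
  have h₃ := h (finFunctionFinEquiv.symm ⟨i, hlen ▸ h₁⟩)
  rw [Holds, Equiv.apply_symm_apply, List.getD_eq_getElem _ _ h₁] at h₃
  rw [Bool.eq_iff_iff, h₃]
  simp [encodeRel]

section Closure

variable {L : FirstOrder.Language.{u, v}} {L' : FirstOrder.Language.{u', v'}}
  {τ : TermMap L L'} {τ' : TermMap L' L} {A : Type w} [L.Structure A] {n : ℕ}

/-- The tables after the generation of the congruence. -/
noncomputable def closure (τ : TermMap L L') (τ' : TermMap L' L) (A : Type w) [L.Structure A]
    (n : ℕ) (s : Tab L → List Bool) : Tab L → List Bool :=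
  (stage (fun _ (x : Fin 2 → Fin _) s => closureTest τ τ' A s (x 0) (x 1)) Tab.cong n)^[n ^ 2] s

theorem Represents.stage {X : L.Structure (Fin n)} {s : Tab L → List Bool} (h : Represents X s)
    (T : (n : ℕ) → (Fin 2 → Fin n) → (Tab L → List Bool) → Prop) :
    Represents X (stage T Tab.cong n s) where
  fn f x := by simpa [StackProgram.stage, Holds] using h.fn f x
  rl R x := by simpa [StackProgram.stage, Holds] using h.rl R x

theorem cong_stage {s : Tab L → List Bool} (x y : Fin n) :
    Cong (stage (fun _ (x : Fin 2 → Fin _) s => closureTest τ τ' A s (x 0) (x 1)) Tab.cong n s)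
      x y ↔ closureTest τ τ' A s x y := by
  rw [Cong, holds_iff_of_eq_encodeRel (R := fun x => closureTest τ τ' A s (x 0) (x 1))
    (by simp [StackProgram.stage])]
  simp

/-- The generated relation is a congruence with the required properties, and homomorphisms to `A`
identify related elements. -/
theorem closure_spec [L'.Structure A]
    (hτ : ∀ k (g : L'.Functions k) (x : Fin (k + 1) → A),
      (τ k g).realize x = funMap g (Fin.init x))
    (hτ' : ∀ k (f : L.Functions k) (x : Fin (k + 1) → A),
      (τ' k f).realize x = funMap f (Fin.init x))
    {X : L.Structure (Fin n)} {s : Tab L → List Bool} (h : Represents X s)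
    (hs : s Tab.cong = []) :
    Represents X (closure τ τ' A n s) ∧
      (∀ x y : Fin n, closureStep τ τ' A (Cong (closure τ τ' A n s)) x y →
        Cong (closure τ τ' A n s) x y) ∧
      ∀ φ : Fin n →[L] A, ∀ x y : Fin n, Cong (closure τ τ' A n s) x y → φ x = φ y := by
  let g : Set (Fin n × Fin n) → Set (Fin n × Fin n) := fun E =>
    {p | closureStep τ τ' A (fun x y => (x, y) ∈ E) p.1 p.2}
  let st := StackProgram.stage (fun _ (x : Fin 2 → Fin _) s => closureTest τ τ' A s (x 0) (x 1))
    (Tab.cong (L := L)) n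
  have key : ∀ j, Represents X (st^[j] s) ∧
      (∀ x y, Cong (st^[j] s) x y ↔ (x, y) ∈ g^[j] ∅) := by
    intro j
    induction j with
    | zero => exact ⟨h, fun x y => by simp [Holds, hs]⟩
    | succ j ih =>
      rw [Function.iterate_succ_apply', Function.iterate_succ_apply']
      refine ⟨ih.1.stage _, fun x y => ?_⟩
      rw [cong_stage, ih.1.closureTest_iff]
      have : Cong (st^[j] s) = fun x y => (x, y) ∈ g^[j] ∅ := by
        funext x y
        exact propext (ih.2 x y)
      rw [this]
      rfl
  refine ⟨(key (n ^ 2)).1, fun x y hxy => ?_, fun φ x y hxy => ?_⟩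
  · have hfix := iterate_fixed_of_card_le g (fun E p hp => Or.inl hp) ∅ (N := n ^ 2)
      (by simp [sq])
    have : Cong (closure τ τ' A n s) = fun x y => (x, y) ∈ g^[n ^ 2] ∅ := by
      funext x y
      exact propext ((key (n ^ 2)).2 x y)
    rw [this] at hxy ⊢
    change (x, y) ∈ g (g^[n ^ 2] ∅) at hxy
    rwa [hfix] at hxy
  · have : ∀ j, ∀ x y, (x, y) ∈ g^[j] ∅ → φ x = φ y := by
      intro j
      induction j with
      | zero => intro x y h; exact absurd h (Set.notMem_empty _)
      | succ j ih =>
        intro x y h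
        rw [Function.iterate_succ_apply'] at h
        exact closureStep_sound hτ hτ' φ ih x y h
    exact this _ x y (((key (n ^ 2)).2 x y).1 hxy)

end Closure

section Encoding

variable {L : FirstOrder.Language.{u, v}}

/-- The arities of the relations in the tables. -/
def tabArity : Tab L → ℕ
  | .fn f => f.1 + 1
  | .rl R => R.1
  | .cong => 2

/-- The characteristic strings describing a structure. -/
noncomputable def tabOf {n : ℕ} (X : L.Structure (Fin n)) : Tab L → List Bool
  | .fn f => encodeRel fun x : Fin (f.1 + 1) → Fin n => X.funMap f.2 (Fin.init x) = x (Fin.last f.1)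
  | .rl R => encodeRel fun x : Fin R.1 → Fin n => X.RelMap R.2 x
  | .cong => []

theorem represents_of_eq_tabOf {n : ℕ} {X : L.Structure (Fin n)} {s : Tab L → List Bool}
    (hf : ∀ f, s (.fn f) = tabOf X (.fn f)) (hr : ∀ R, s (.rl R) = tabOf X (.rl R)) :
    Represents X s :=
  ⟨fun f x => holds_iff_of_eq_encodeRel
      (R := fun x : Fin (f.1 + 1) → Fin n => X.funMap f.2 (Fin.init x) = x (Fin.last f.1)) (hf f) x,
    fun R x => holds_iff_of_eq_encodeRel (R := fun x : Fin R.1 → Fin n => X.RelMap R.2 x) (hr R) x⟩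

theorem valid_iff {A : Type w} [L.Structure A] {n : ℕ} {X : L.Structure (Fin n)}
    {s : Tab L → List Bool} (h : Represents X s) :
    Valid A n s ↔ ∀ k (R : L.Relations k), (∃ a : Fin k → Fin n, RelMap R a) →
      ∃ t : Fin k → A, RelMap R t := by
  constructor
  · rintro hv k R ⟨a, ha⟩
    exact (hv.2 ⟨k, R⟩).resolve_right fun h' => h' ⟨a, (h.rl ⟨k, R⟩ a).2 ha⟩
  · intro hR
    refine ⟨fun f a => ⟨X.funMap f.2 a, ?_, ?_⟩, fun R => ?_⟩
    · simp [h.fn]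
    · intro z' hz'
      simpa using ((h.fn _ _).1 hz').symm
    · by_cases ha : ∃ a : Fin R.1 → Fin n, RelMap R.2 a
      · exact .inl (hR R.1 R.2 ha)
      · refine .inr fun h' => ha ?_
        obtain ⟨a, ha⟩ := h'
        exact ⟨a, (h.rl R a).1 ha⟩

/-- The empty structure admits a homomorphism if its nullary relations allow it. -/
theorem nonempty_hom_of_valid_zero {A : Type w} [L.Structure A] {X : L.Structure (Fin 0)}
    {s : Tab L → List Bool} (h : Represents X s) (hv : Valid A 0 s) : Nonempty (Fin 0 →[L] A) := by
  refine ⟨⟨fun x => x.elim0, fun {k} f a => (funMap f a).elim0, fun {k} R a ha => ?_⟩⟩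
  rcases hv.2 ⟨k, R⟩ with ⟨t, ht⟩ | hR
  · cases k with
    | zero => rwa [Subsingleton.elim ((fun x : Fin 0 => x.elim0) ∘ a) t]
    | succ k => exact (a 0).elim0
  · exact absurd ⟨a, (h.rl ⟨k, R⟩ a).2 ha⟩ hR

variable (L) [Fintype (Σ k, L.Functions k)] [Fintype (Σ k, L.Relations k)]

/-- The tables of the encoding of a structure, in the order of their appearance. -/
noncomputable def tabList : List (Tab L) :=
  (Finset.univ : Finset (Σ k, L.Functions k)).toList.map Tab.fn ++
    (Finset.univ : Finset (Σ k, L.Relations k)).toList.map Tab.rl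

variable {L}

theorem fn_mem_tabList (f : Σ k, L.Functions k) : Tab.fn f ∈ tabList L := by simp [tabList]

theorem rl_mem_tabList (R : Σ k, L.Relations k) : Tab.rl R ∈ tabList L := by simp [tabList]

theorem cong_notMem_tabList : Tab.cong ∉ tabList L := by simp [tabList]

theorem nodup_tabList : (tabList L).Nodup := by
  refine List.Nodup.append ?_ ?_ ?_
  · exact (Finset.nodup_toList _).map fun f g h => by injection h
  · exact (Finset.nodup_toList _).map fun f g h => by injection h
  · intro a h₁ h₂
    simp only [List.mem_map] at h₁ h₂
    obtain ⟨f, _, rfl⟩ := h₁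
    obtain ⟨R, _, h⟩ := h₂
    cases h

theorem length_tabOf {n : ℕ} (X : L.Structure (Fin n)) {a : Tab L} (ha : a ∈ tabList L) :
    (tabOf X a).length = n ^ tabArity a := by
  cases a with
  | fn f => simp [tabOf, tabArity, length_encodeRel]
  | rl R => simp [tabOf, tabArity, length_encodeRel]
  | cong => exact absurd ha cong_notMem_tabList

theorem encode_eq {n : ℕ} (X : L.Structure (Fin n)) :
    encode L X = List.replicate n true ++ false :: (tabList L).flatMap (tabOf X) := by
  rw [encode, tabList, List.flatMap_append, List.flatMap_map, List.flatMap_map]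
  rfl

/-- Tables of the right lengths that describe graphs of functions come from a structure. -/
theorem exists_structure_of_valid {A : Type w} [L.Structure A] {n : ℕ} {s : Tab L → List Bool}
    (hlen : ∀ a ∈ tabList L, (s a).length = n ^ tabArity a) (h : Valid A n s) :
    ∃ X : L.Structure (Fin n), ∀ a ∈ tabList L, s a = tabOf X a := by
  choose F hF hF' using h.1
  let X : L.Structure (Fin n) := ⟨fun {k} f a => F ⟨k, f⟩ a, fun {k} R a => Holds s (.rl ⟨k, R⟩) a⟩
  refine ⟨X, fun a ha => ?_⟩
  cases a with
  | fn f =>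
    refine eq_encodeRel_of_holds_iff
      (R := fun x : Fin (f.1 + 1) → Fin n => X.funMap f.2 (Fin.init x) = x (Fin.last f.1))
      (hlen _ ha) fun x => ?_
    constructor
    · intro hx
      rw [← Fin.snoc_init_self x] at hx
      exact (hF' f (Fin.init x) _ hx).symm
    · intro hx
      have := hF f (Fin.init x)
      change F f (Fin.init x) = x (Fin.last f.1) at hx
      rwa [hx, Fin.snoc_init_self] at this
  | rl R =>
    exact eq_encodeRel_of_holds_iff (R := fun x : Fin R.1 → Fin n => X.RelMap R.2 x)
      (hlen _ ha) fun x => Iff.rfl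
  | cong => exact absurd ha cong_notMem_tabList

theorem flatMap_injective_of_length {α β : Type*} {l : List α} {c c' : α → List β}
    (hlen : ∀ a ∈ l, (c a).length = (c' a).length) (h : l.flatMap c = l.flatMap c') :
    ∀ a ∈ l, c a = c' a := by
  induction l with
  | nil => simp
  | cons a l ih =>
    rw [List.flatMap_cons, List.flatMap_cons] at h
    obtain ⟨h₁, h₂⟩ := List.append_inj h (hlen a (by simp))
    intro b hb
    rcases List.mem_cons.1 hb with rfl | hb
    · exact h₁
    · exact ih (fun a ha => hlen a (by simp [ha])) h₂ b hb

theorem replicate_append_false_inj {n m : ℕ} {l l' : List Bool}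
    (h : List.replicate n true ++ false :: l = List.replicate m true ++ false :: l') :
    n = m ∧ l = l' := by
  induction n generalizing m with
  | zero =>
    cases m with
    | zero => simpa using h
    | succ m => simp [List.replicate_succ] at h
  | succ n ih =>
    cases m with
    | zero => simp [List.replicate_succ] at h
    | succ m =>
      have := ih (m := m) (by simpa [List.replicate_succ] using h)
      exact ⟨by omega, this.2⟩

theorem encode_injective {n : ℕ} {X X' : L.Structure (Fin n)} (h : encode L X = encode L X') :
    X = X' := by
  rw [encode_eq, encode_eq] at h
  have h₁ := flatMap_injective_of_length
    (fun a ha => (length_tabOf X ha).trans (length_tabOf X' ha).symm)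
    (replicate_append_false_inj h).2
  have r : Represents X (tabOf X) := represents_of_eq_tabOf (fun _ => rfl) fun _ => rfl
  have r' : Represents X' (tabOf X) := represents_of_eq_tabOf
    (fun f => h₁ _ (fn_mem_tabList f)) fun R => h₁ _ (rl_mem_tabList R)
  refine Structure.ext ?_ ?_
  · funext k f a
    have h₃ := (r.fn ⟨k, f⟩ (Fin.snoc a (X.funMap f a))).2 (by simp)
    have h₄ := (r'.fn ⟨k, f⟩ (Fin.snoc a (X.funMap f a))).1 h₃
    simpa using h₄.symm
  · funext k R a
    exact propext ((r.rl ⟨k, R⟩ a).symm.trans (r'.rl ⟨k, R⟩ a))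

theorem encode_mem_CSP_iff {A : Type w} [L.Structure A] {n : ℕ} (X : L.Structure (Fin n)) :
    encode L X ∈ CSP L A ↔ Nonempty (Fin n →[L] A) := by
  constructor
  · rintro ⟨m, X', h, hom⟩
    obtain rfl : m = n := by
      rw [encode_eq, encode_eq] at h
      exact (replicate_append_false_inj h).1
    obtain rfl := encode_injective h
    exact hom
  · exact fun h => ⟨n, X, rfl, h⟩

theorem exists_mem_CSP (A : Type w) [Finite A] [L.Structure A] : ∃ x, x ∈ CSP L A := by
  let e := Finite.equivFin A
  let X : L.Structure (Fin (Nat.card A)) := e.inducedStructure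
  refine ⟨encode L X, _, X, rfl, ⟨?_⟩⟩
  exact (e.inducedStructureEquiv (L := L)).symm.toHom

theorem false_mem_of_mem_CSP {A : Type w} [L.Structure A] {x : List Bool} (h : x ∈ CSP L A) :
    false ∈ x := by
  obtain ⟨n, X, rfl, _⟩ := h
  rw [encode_eq]
  simp

end Encoding

section Output

variable {L : FirstOrder.Language.{u, v}}

/-- The word put out by the reduction for a nonempty structure. -/
noncomputable def outputWord (L' : FirstOrder.Language.{u', v'}) [Fintype (Σ k, L'.Functions k)]
    [Fintype (Σ k, L'.Relations k)] (τ : TermMap L L') (A : Type w) [L.Structure A]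
    [L'.Structure A] (n : ℕ) (s : Tab L → List Bool) : List Bool :=
  List.replicate n true ++ false ::
    ((Finset.univ : Finset (Σ k, L'.Functions k)).toList.flatMap (fun g =>
        encodeRel (n := n) (outputFn τ g s))
      ++ (Finset.univ : Finset (Σ k, L'.Relations k)).toList.flatMap (fun Q =>
        encodeRel (n := n) (outputRl A Q s)))

/-- The output word encodes a structure that admits a homomorphism to `A` if and only if the given
structure does. -/
theorem outputWord_mem_CSP_iff (L' : FirstOrder.Language.{u', v'}) [Fintype (Σ k, L'.Functions k)]
    [Fintype (Σ k, L'.Relations k)] {τ : TermMap L L'} {τ' : TermMap L' L} {A : Type w} [Finite A]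
    [L.Structure A] [L'.Structure A]
    (hpartial : partialPolymorphisms L A = partialPolymorphisms L' A)
    (hτ : ∀ k (g : L'.Functions k) (x : Fin (k + 1) → A),
      (τ k g).realize x = funMap g (Fin.init x))
    (hτ' : ∀ k (f : L.Functions k) (x : Fin (k + 1) → A),
      (τ' k f).realize x = funMap f (Fin.init x))
    {n : ℕ} (hn : 0 < n) {X : L.Structure (Fin n)} {s : Tab L → List Bool}
    (h : Represents X s) (hs : s Tab.cong = []) (hv : Valid A n s) :
    outputWord L' τ A n (closure τ τ' A n s) ∈ CSP L' A ↔ Nonempty (Fin n →[L] A) := by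
  obtain ⟨hrep, hclosed, hsound⟩ := closure_spec hτ hτ' h hs
  generalize closure τ τ' A n s = s' at *
  have hrefl : ∀ x : Fin n, Cong s' x x := fun x => hclosed _ _ (.inr <| .inl rfl)
  have hsymm : ∀ {x y : Fin n}, Cong s' x y → Cong s' y x := fun h =>
    hclosed _ _ (.inr <| .inr <| .inl h)
  have htrans : ∀ {x y z : Fin n}, Cong s' x y → Cong s' y z → Cong s' x z := fun h h' =>
    hclosed _ _ (.inr <| .inr <| .inr <| .inl ⟨_, h, h'⟩)
  have hex : ∀ x : Fin n, ∃ v, IsRep s' x v := fun x => by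
    obtain ⟨v, hv, hmin⟩ := WellFounded.has_min (wellFounded_lt (α := Fin n)) {y | Cong s' x y}
      ⟨x, hrefl x⟩
    exact ⟨v, hv, fun y hy => not_lt.1 (hmin y hy)⟩
  choose rep hrep' using hex
  have huniq : ∀ {x v : Fin n}, IsRep s' x v → rep x = v := fun {x v} h =>
    le_antisymm ((hrep' x).2 _ h.1) (h.2 _ (hrep' x).1)
  have hcongr : ∀ x y : Fin n, Cong s' x y → rep x = rep y := fun x y hxy =>
    huniq ⟨htrans hxy (hrep' y).1, fun z hz => (hrep' y).2 z (htrans (hsymm hxy) hz)⟩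
  let Y : L'.Structure (Fin n) := quotientStructure L L' τ A (Cong s') rep ⟨0, hn⟩
  have hout : outputWord L' τ A n s' = encode L' Y := by
    rw [outputWord, encode]
    congr 4
    · funext g
      congr 1
      funext z
      refine propext ⟨?_, fun hz => ?_⟩
      · rintro ⟨d, x, hx, hz⟩
        rw [hrep.termHolds] at hx
        change rep _ = _
        rw [← huniq hz]
        refine hcongr _ _ (hclosed _ _ (.inr <| .inr <| .inr <| .inr <| .inr <| .inr <| .inl
          ⟨g, Fin.snoc (α := fun _ => Fin n) (Fin.init z) ⟨0, hn⟩, _, ?_, rfl, hx⟩))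
        simp
      · refine ⟨⟨0, hn⟩, _, (hrep.termHolds _ _ _).2 rfl, ?_⟩
        change rep _ = _ at hz
        rw [← hz]
        exact hrep' _
    · funext Q
      congr 1
      funext y
      simp only [outputRl, hrep.rl]
      rfl
  rw [hout, encode_mem_CSP_iff, nonempty_hom_iff hpartial hτ hτ' hclosed hsound
    ((valid_iff h).1 hv) rep (fun x => (hrep' x).1) hcongr ⟨0, hn⟩]

end Output

end FinCSP

/-! ### Input, output, and clearing the stacks -/

namespace StackProgram

theorem eval_mono (p : Polynomial ℕ) {m n : ℕ} (h : m ≤ n) : p.eval m ≤ p.eval n := by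
  rw [Polynomial.eval_eq_sum, Polynomial.eval_eq_sum]
  exact Finset.sum_le_sum fun i _ => Nat.mul_le_mul_left _ (Nat.pow_le_pow_left h i)

section Clear

variable {K : Type u} [DecidableEq K]

theorem Runs.length_le {p : Prog K} {a b : Reg × (K → List Bool)} {t : ℕ} (h : Runs p a b t)
    (k : K) : (b.2 k).length ≤ (a.2 k).length + t := by
  induction h with
  | push j f r S =>
    by_cases hk : k = j
    · subst hk; simp
    · simp [hk]
  | pop j f r S =>
    by_cases hk : k = j
    · subst hk; simp; omega
    · simp [hk]
  | load => simp
  | seq _ _ ih₁ ih₂ => omega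
  | ite_true _ _ ih => omega
  | ite_false _ _ ih => omega
  | loop_false => simp
  | loop_true _ _ _ ih₁ ih₂ => omega

theorem Runs.eq_of_notMem {p : Prog K} {a b : Reg × (K → List Bool)} {t : ℕ} (h : Runs p a b t)
    {k : K} (hk : k ∉ p.supp) : b.2 k = a.2 k := by
  induction h with
  | push j f r S =>
    have : k ≠ j := by simpa [Prog.supp] using hk
    simp [this]
  | pop j f r S =>
    have : k ≠ j := by simpa [Prog.supp] using hk
    simp [this]
  | load => rfl
  | seq _ _ ih₁ ih₂ =>
    simp only [Prog.supp, Finset.mem_union, not_or] at hk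
    rw [ih₂ hk.2, ih₁ hk.1]
  | ite_true _ _ ih =>
    simp only [Prog.supp, Finset.mem_union, not_or] at hk
    exact ih hk.1
  | ite_false _ _ ih =>
    simp only [Prog.supp, Finset.mem_union, not_or] at hk
    exact ih hk.2
  | loop_false => rfl
  | loop_true _ _ _ ih₁ ih₂ => rw [ih₂ hk, ih₁ hk]

/-- Empties the listed stacks. -/
def clearAll : List K → Prog K
  | [] => skip
  | k :: ks => .seq (clear k) (clearAll ks)

theorem does_clearAll {b : Bool} {N : ℕ} (ks : List K) {S : K → List Bool}
    (hN : ∀ k, (S k).length ≤ N) :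
    Does (clearAll ks) b S b (fun k => if k ∈ ks then [] else S k)
      ((3 * N + 2) * ks.length + 1) := by
  induction ks generalizing S with
  | nil => exact Does.of does_skip rfl (by simp) (by simp)
  | cons k ks ih =>
    have h := ih (S := Function.update S k []) fun j => by
      by_cases hj : j = k
      · subst hj; simp
      · simpa [hj] using hN j
    refine Does.of ((does_clear k).seq h) rfl ?_ ?_
    · funext j
      by_cases hj : j = k <;> simp [hj]
    · have := hN k
      rw [List.length_cons]
      ring_nf
      omega

/-- A function computed by a stack program in polynomial time is computed by a `TM2` machine in
polynomial time. The stacks other than the output stack need not be empty at the end: emptying them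
takes time linear in the length of the input plus the running time. -/
theorem computableInPolyTime_of_does (p : Prog K) {kin kout : K} (f : List Bool → List Bool)
    (T : Polynomial ℕ)
    (h : ∀ x, ∃ b S, Does p false (single kin x) b S (T.eval x.length) ∧ S kout = f x) :
    Nonempty (Turing.TM2ComputableInPolyTime (fun x : List Bool => x) (fun x : List Bool => x)
      f) := by
  let ks : List K := ((p.supp ∪ {kin}).erase kout).toList
  refine computableInPolyTime (.seq p (.seq (clearAll ks) (.load fun _ => (false, none)))) kin kout
    f (T + (3 * (Polynomial.X + T) + 2) * (ks.length : Polynomial ℕ) + 2) fun x => ?_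
  obtain ⟨b, S, hd, hS⟩ := h x
  obtain ⟨o, t, ht, hr⟩ := hd none
  have hlen : ∀ k, (S k).length ≤ x.length + T.eval x.length := fun k => by
    have h₁ := hr.length_le k
    have h₂ : (single kin x k).length ≤ x.length := by
      by_cases hk : k = kin
      · subst hk; simp [single]
      · simp [single, hk]
    simp only at h₁
    omega
  obtain ⟨o', t', ht', hr'⟩ := does_clearAll (b := b) ks hlen o
  have hend : (fun k => if k ∈ ks then [] else S k) = single kout (f x) := by
    funext k
    by_cases hk : k = kout
    · subst hk; simp [single, ks, hS]
    · by_cases hk' : k ∈ ks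
      · simp [single, hk, hk']
      · have hk'' : k ∉ p.supp ∧ k ≠ kin := by
          simpa [ks, hk, and_comm] using hk'
        have := hr.eq_of_notMem hk''.1
        simp only at this
        rw [if_neg hk', this]
        simp [single, hk, hk''.2]
  rw [hend] at hr'
  refine ⟨t + (t' + 1), ?_, hr.seq (hr'.seq (.load _ _ _))⟩
  simp
  omega

end Clear

section Input

variable {Arr : Type u}

open Stk
open scoped Classical

/-- Reads the unary number at the beginning of the input up to its end mark, and leaves it on the
stack `size`. The flag tells whether the end mark was found. -/
noncomputable def readSize : Prog (Stk Arr) :=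
  .seq (popBit inp) <|
  .seq (.loop (fun r => r.2 == some true) (.seq (pushBit size true) (popBit inp)))
    (.load fun r => (r.2.isSome, r.2))

/-- The remaining input `l` starts with the end mark, or else is empty. -/
theorem does_readSize {b : Bool} {S : Stk Arr → List Bool} (n : ℕ) (l : List Bool)
    (hl : l.head? ≠ some true) (hi : S inp = un n ++ l) :
    Does readSize b S l.head?.isSome
      (Function.update (Function.update S inp l.tail) size (un n ++ S size)) (3 * n + 3) := by
  have key : ∀ (n : ℕ) (S : Stk Arr → List Bool) (r : Reg), S inp = un n ++ l →
      Runs (.seq (popBit inp)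
        (.loop (fun r => r.2 == some true) (.seq (pushBit size true) (popBit inp)))) (r, S)
        ((r.1, l.head?), Function.update (Function.update S inp l.tail) size (un n ++ S size))
        (3 * n + 2) := by
    intro n
    induction n with
    | zero =>
      intro S r hi
      have h₁ := runs_popBit (b := r.1) (o := r.2) (S := S) inp
      rw [hi] at h₁
      have h := h₁.seq (u := 1) (.loop_false (c := fun r => r.2 == some true)
        (p := .seq (pushBit size true) (popBit inp)) (by simpa using hl))
      have e : Function.update (Function.update S inp l.tail) size (S size) =
          Function.update S inp l.tail := by
        rw [Function.update_eq_self_iff]; simp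
      simpa [e] using h
    | succ n ih =>
      intro S r hi
      have h₁ := runs_popBit (b := r.1) (o := r.2) (S := S) inp
      rw [hi] at h₁
      simp only [List.replicate_succ, List.cons_append, List.head?_cons, List.tail_cons] at h₁
      have h₂ := Runs.push size (fun _ => true) (r.1, some true)
        (Function.update S inp (un n ++ l))
      have h₃ := ih (Function.update (Function.update S inp (un n ++ l)) size
        (true :: (Function.update S inp (un n ++ l)) size)) (r.1, some true) (by simp)
      have e : Function.update (Function.update (Function.update (Function.update S inp
          (un n ++ l)) size (true :: (Function.update S inp (un n ++ l)) size))
          inp l.tail) size (un n ++ (true :: S size)) =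
          Function.update (Function.update S inp l.tail) size (un (n + 1) ++ S size) := by
        have : un n ++ (true :: S size) = un (n + 1) ++ S size := by
          rw [show un (n + 1) = un n ++ [true] from List.replicate_succ', List.append_assoc]; rfl
        rw [this]
        funext j
        by_cases h₁ : j = size <;> by_cases h₂ : j = inp <;> simp_all
      simp only [Function.update_self, ne_eq, reduceCtorEq, not_false_eq_true,
        Function.update_of_ne] at h₃ h₂ e
      rw [e] at h₃
      generalize hT : 3 * n + 2 = T at h₃
      cases h₃ with
      | @seq _ _ _ c _ t u hpop hloop =>
        have h := h₁.seq (.loop_true (c := fun r => r.2 == some true) rfl (h₂.seq hpop) hloop)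
        have ht : 1 + (1 + t + u + 1) = 3 * (n + 1) + 2 := by omega
        rw [← ht]
        exact h
  intro o
  have h := key n S (b, o) hi
  generalize hT : 3 * n + 2 = T at h
  cases h with
  | @seq _ _ _ c _ t u h₁ h₂ =>
    exact ⟨l.head?, t + (u + 1), by omega, h₁.seq (h₂.seq (.load _ _ _))⟩

/-- Reads a table with `n ^ k` entries from the input; clears the flag if the input is too short. -/
noncomputable def readTable (a : Arr) (k : ℕ) : Prog (Stk Arr) :=
  .seq (power k) <|
  .seq (drain iter (.seq (popBit inp) (ifPopped (pushPopped tmp) (setFlag fun _ => false))))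
    (move tmp (arr a))

theorem does_readTable {a : Arr} {k n : ℕ} {S : Stk Arr → List Bool} (hS : Ready n S)
    (hi : S iter = []) (ha : S (arr a) = []) :
    Does (readTable a k) true S (decide (n ^ k ≤ (S inp).length))
      (Function.update (Function.update S inp ((S inp).drop (n ^ k))) (arr a)
        ((S inp).take (n ^ k)))
      ((powerTime k + 8 * Polynomial.X ^ k + 4).eval n) := by
  have h₁ := does_power (b := true) k hS.size hS.tmp hS.aux hi
  have h₂ := does_drain (k := iter)
    (p := .seq (popBit inp) (ifPopped (pushPopped tmp) (setFlag fun _ => false)))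
    (T := 3) (un (n ^ k)) (fun m => decide (n ^ k - m.length ≤ (S inp).length))
    (fun m => Function.update (Function.update (Function.update S inp
      ((S inp).drop (n ^ k - m.length))) tmp ((S inp).take (n ^ k - m.length)).reverse) iter m)
    (by simp)
    (fun y m hm => by
      have hm' : m.length + 1 ≤ n ^ k := by simpa using hm.length_le
      obtain ⟨d, hd⟩ := Nat.exists_eq_add_of_le hm'
      have e₁ : n ^ k - m.length = d + 1 := by omega
      have e₂ : n ^ k - (y :: m).length = d := by
        rw [List.length_cons]; omega
      rw [e₁, e₂]
      refine does_popBit_seq (T := 2) ?_ _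
      rcases hd : (S inp).drop d with _ | ⟨z, l⟩
      · have hlen : (S inp).length ≤ d := by simpa using hd
        have e₃ : (S inp).drop (d + 1) = [] := by
          rw [← List.drop_drop, hd]; rfl
        have e₄ : (S inp).take (d + 1) = (S inp).take d := by
          rw [List.take_of_length_le (by omega), List.take_of_length_le hlen]
        have f : decide (d + 1 ≤ (S inp).length) = false := by
          rw [decide_eq_false_iff_not]; omega
        simp only [ne_eq, reduceCtorEq, not_false_eq_true, Function.update_of_ne,
          Function.update_self, List.head?_nil]
        refine doesAt_ifPopped_none ?_
        refine DoesAt.of (does_setFlag (fun _ => false) none) f.symm ?_ (by omega)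
        rw [e₃, e₄]
        funext j
        by_cases h₁ : j = iter <;> by_cases h₂ : j = tmp <;> by_cases h₃ : j = inp <;>
          simp_all
      · have hlen : d < (S inp).length := by
          have : ((S inp).drop d).length = l.length + 1 := by rw [hd]; rfl
          rw [List.length_drop] at this
          omega
        have e₃ : (S inp).drop (d + 1) = l := by
          rw [← List.drop_drop, hd]; rfl
        have e₄ : (S inp).take (d + 1) = (S inp).take d ++ [z] := by
          rw [List.take_add, hd]; rfl
        have f₁ : decide (d ≤ (S inp).length) = true := decide_eq_true hlen.le
        have f₂ : decide (d + 1 ≤ (S inp).length) = true := decide_eq_true hlen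
        rw [f₁, f₂]
        simp only [ne_eq, reduceCtorEq, not_false_eq_true, Function.update_of_ne,
          Function.update_self, List.head?_cons]
        refine doesAt_ifPopped_some ?_
        refine DoesAt.of (doesAt_pushPopped tmp z) rfl ?_ (by omega)
        rw [e₃, e₄]
        funext j
        by_cases h₁ : j = iter <;> by_cases h₂ : j = tmp <;> by_cases h₃ : j = inp <;>
          simp_all)
  have h0 : Function.update (Function.update (Function.update S inp
      ((S inp).drop (n ^ k - (un (n ^ k)).length))) tmp
      ((S inp).take (n ^ k - (un (n ^ k)).length)).reverse) iter (un (n ^ k)) =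
      Function.update S iter (un (n ^ k)) := by
    have := hS.tmp
    funext j
    by_cases h₁ : j = iter <;> by_cases h₂ : j = tmp <;> by_cases h₃ : j = inp <;> simp_all
  have h0' : decide (n ^ k - (un (n ^ k)).length ≤ (S inp).length) = true := by simp
  rw [h0, h0'] at h₂
  simp only [List.length_nil, Nat.sub_zero, List.length_replicate] at h₂
  refine Does.of (h₁.seq (h₂.seq (does_move (by simp)))) rfl ?_ ?_
  · have := hS.tmp
    funext j
    by_cases h₁ : j = iter <;> by_cases h₂ : j = tmp <;> by_cases h₃ : j = inp <;>
      by_cases h₄ : j = arr a <;> simp_all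
  · have : ((S inp).take (n ^ k)).length ≤ n ^ k := by simp
    simp
    omega

theorem Ready.update_inp {n : ℕ} {S : Stk Arr → List Bool} (hS : Ready n S) (l : List Bool) :
    Ready n (Function.update S inp l) where
  size := by simpa using hS.size
  addr := by simpa using hS.addr
  tmp := by simpa using hS.tmp
  aux := by simpa using hS.aux
  ctr_lt i := i.elim0
  ctr_ge i hi := by simpa using hS.ctr_ge i hi

/-- Reads the listed tables from the input, stopping if the input is too short. -/
noncomputable def readTables (ar : Arr → ℕ) : List Arr → Prog (Stk Arr)
  | [] => skip
  | a :: as => .seq (readTable a (ar a)) (ifFlag (readTables ar as) skip)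

/-- A bound for the running time of `readTables`. -/
noncomputable def readTablesTime (ar : Arr → ℕ) : List Arr → Polynomial ℕ
  | [] => 1
  | a :: as => powerTime (ar a) + 8 * Polynomial.X ^ ar a + 4 + (readTablesTime ar as + 2)

theorem does_readTables {ar : Arr → ℕ} {n : ℕ} {as : List Arr} (hnd : as.Nodup)
    {S : Stk Arr → List Bool} (hS : Ready n S) (hi : S iter = []) (ha : ∀ a ∈ as, S (arr a) = [])
    (c : Arr → List Bool) (l : List Bool) (hc : ∀ a ∈ as, (c a).length = n ^ ar a)
    (hl : S inp = as.flatMap c ++ l) :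
    Does (readTables ar as) true S true
      (withTables (Function.update S inp l) fun a => if a ∈ as then c a else S (arr a))
      ((readTablesTime ar as).eval n) := by
  induction as generalizing S with
  | nil =>
    refine Does.of does_skip rfl ?_ (by simp [readTablesTime])
    funext j
    cases j with
    | inp => simpa [withTables] using hl
    | _ => simp [withTables]
  | cons a as ih =>
    have h₁ := does_readTable (a := a) (k := ar a) hS hi (ha a (by simp))
    have hlen := hc a (by simp)
    rw [List.flatMap_cons, List.append_assoc] at hl
    have e₁ : (S inp).take (n ^ ar a) = c a := by rw [hl, ← hlen]; simp
    have e₂ : (S inp).drop (n ^ ar a) = as.flatMap c ++ l := by rw [hl, ← hlen]; simp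
    have e₃ : decide (n ^ ar a ≤ (S inp).length) = true := by
      rw [hl, ← hlen]; simp
    rw [e₁, e₂, e₃] at h₁
    have hne : ∀ a' ∈ as, a' ≠ a := fun a' h h' => (List.nodup_cons.1 hnd).1 (h' ▸ h)
    have h₂ := ih (S := Function.update (Function.update S inp (as.flatMap c ++ l)) (arr a) (c a))
      (List.nodup_cons.1 hnd).2 ((hS.update_inp _).update_arr _ _) (by simpa using hi)
      (fun a' h => by simpa [hne a' h] using ha a' (by simp [h]))
      (fun a' h => hc a' (by simp [h])) (by simp)
    refine Does.of (h₁.seq (does_ifFlag_true h₂)) rfl ?_ (by simp [readTablesTime])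
    funext j
    cases j with
    | arr a' =>
      by_cases h : a' = a
      · subst h; simp [withTables]
      · simp [withTables, h]
    | inp => simp [withTables]
    | _ => simp [withTables]

theorem does_readTables_fail {ar : Arr → ℕ} {n : ℕ} {as : List Arr} (hnd : as.Nodup)
    {S : Stk Arr → List Bool} (hS : Ready n S) (hi : S iter = []) (ha : ∀ a ∈ as, S (arr a) = [])
    (hl : ¬ ∃ (c : Arr → List Bool) (l : List Bool), (∀ a ∈ as, (c a).length = n ^ ar a) ∧
      S inp = as.flatMap c ++ l) :
    ∃ S', S' out = S out ∧ Does (readTables ar as) true S false S'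
      ((readTablesTime ar as).eval n) := by
  induction as generalizing S with
  | nil => exact absurd ⟨fun _ => [], S inp, by simp, by simp⟩ hl
  | cons a as ih =>
    have h₁ := does_readTable (a := a) (k := ar a) hS hi (ha a (by simp))
    by_cases hlen : n ^ ar a ≤ (S inp).length
    · rw [decide_eq_true hlen] at h₁
      have hne : ∀ a' ∈ as, a' ≠ a := fun a' h h' => (List.nodup_cons.1 hnd).1 (h' ▸ h)
      obtain ⟨S', hS', h₂⟩ := ih (S := Function.update
        (Function.update S inp ((S inp).drop (n ^ ar a))) (arr a) ((S inp).take (n ^ ar a)))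
        (List.nodup_cons.1 hnd).2 ((hS.update_inp _).update_arr _ _) (by simpa using hi)
        (fun a' h => by simpa [hne a' h] using ha a' (by simp [h]))
        (by
          rintro ⟨c, l, hc, hcl⟩
          refine hl ⟨Function.update c a ((S inp).take (n ^ ar a)), l, ?_, ?_⟩
          · intro a' ha'
            by_cases h : a' = a
            · subst h; simpa using hlen
            · simpa [h] using hc a' (by simpa [h] using ha')
          · have e : as.flatMap (Function.update c a ((S inp).take (n ^ ar a))) = as.flatMap c :=
              List.flatMap_congr fun a' ha' => by simp [hne a' ha']
            simp only [ne_eq, reduceCtorEq, not_false_eq_true, Function.update_of_ne,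
              Function.update_self] at hcl
            rw [List.flatMap_cons, e, Function.update_self, List.append_assoc, ← hcl]
            simp)
      refine ⟨S', by simpa using hS', ?_⟩
      exact Does.of (h₁.seq (does_ifFlag_true h₂)) rfl rfl (by simp [readTablesTime])
    · rw [decide_eq_false hlen] at h₁
      refine ⟨_, ?_, Does.of (h₁.seq (does_ifFlag_false does_skip)) rfl rfl
        (by simp [readTablesTime])⟩
      simp

/-- Sets the flag according to whether the input is exhausted. -/
noncomputable def checkEmpty : Prog (Stk Arr) := .pop inp fun _ x => (x.isNone, x)

theorem does_checkEmpty {b : Bool} {S : Stk Arr → List Bool} :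
    Does checkEmpty b S (S inp).head?.isNone (Function.update S inp (S inp).tail) 1 :=
  fun o => ⟨_, 1, le_rfl, .pop inp (fun _ x => (x.isNone, x)) (b, o) S⟩

/-- Pushes the word `w` on the output. -/
noncomputable def emitConst : List Bool → Prog (Stk Arr)
  | [] => skip
  | x :: w => .seq (emitConst w) (pushBit out x)

theorem does_emitConst {b : Bool} {S : Stk Arr → List Bool} (w : List Bool) :
    Does (emitConst w) b S b (Function.update S out (w ++ S out)) (w.length + 1) := by
  induction w with
  | nil => exact Does.of does_skip rfl (by simp) (by simp)
  | cons x w ih => exact Does.of (ih.seq (does_pushBit _ _)) rfl (by simp) (by simp)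

theorem Emits.append {W W' : ℕ → (Arr → List Bool) → List Bool} (h : Emits W) (h' : Emits W') :
    Emits fun n s => W n s ++ W' n s := by
  obtain ⟨P, p, hP⟩ := h
  obtain ⟨P', p', hP'⟩ := h'
  refine ⟨.seq P' P, p' + p, fun n S hS hn b => ?_⟩
  have h₁ := hP' n S hS hn b
  have h₂ := hP n _ (hS.update_out (W' n (tables S) ++ S out)) (by simpa using hn) true
  have e : tables (Function.update S out (W' n (tables S) ++ S out)) = tables S := by
    funext a; simp [tables]
  rw [e] at h₂
  exact Does.of (h₁.seq h₂) rfl (by simp) (by simp)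

theorem emits_const (w : List Bool) : Emits (Arr := Arr) fun _ _ => w :=
  ⟨.seq (setFlag fun _ => true) (emitConst w), (w.length : Polynomial ℕ) + 2, fun n S _ _ b =>
    Does.of ((does_setFlag fun _ => true).seq (does_emitConst w)) rfl rfl (by simp; omega)⟩

theorem emits_size : Emits (Arr := Arr) fun n _ => un n :=
  ⟨.seq (setFlag fun _ => true) (copy tmp size out), 7 * Polynomial.X + 5, fun n S hS _ b =>
    Does.of ((does_setFlag fun _ => true).seq (does_copy (by simp) (by simp) (by simp) hS.tmp)) rfl
      (by simp [hS.size]) (by simp [hS.size]; omega)⟩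

theorem Emits.flatMap {ι : Type*} {W : ι → ℕ → (Arr → List Bool) → List Bool} (l : List ι)
    (h : ∀ i, Emits (W i)) : Emits fun n s => l.flatMap fun i => W i n s := by
  induction l with
  | nil => simpa using emits_const []
  | cons i l ih => simpa using (h i).append ih

end Input

end StackProgram

/-! ### The reduction -/

namespace FinCSP

open FirstOrder.Language FirstOrder.Language.Structure StackProgram Stk

theorem exists_eq_replicate_append (x : List Bool) :
    ∃ n l, x = un n ++ l ∧ l.head? ≠ some true := by
  induction x with
  | nil => exact ⟨0, [], rfl, by simp⟩
  | cons b x ih =>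
    cases b with
    | false => exact ⟨0, false :: x, rfl, by simp⟩
    | true =>
      obtain ⟨n, l, rfl, hl⟩ := ih
      exact ⟨n + 1, l, rfl, hl⟩

theorem nil_notMem_CSP {L : FirstOrder.Language.{u, v}} [Fintype (Σ k, L.Functions k)]
    [Fintype (Σ k, L.Relations k)] {A : Type w} [L.Structure A] : [] ∉ CSP L A :=
  fun h => by simpa using false_mem_of_mem_CSP h

/-- The stacks after the size has been read. -/
noncomputable def afterSize {Arr : Type u} (n : ℕ) (l : List Bool) : Stk Arr → List Bool :=
  Function.update (single inp l) size (un n)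

theorem ready_afterSize {Arr : Type u} (n : ℕ) (l : List Bool) :
    Ready n (afterSize (Arr := Arr) n l) where
  size := by simp [afterSize]
  addr := by simp [afterSize, single]
  tmp := by simp [afterSize, single]
  aux := by simp [afterSize, single]
  ctr_lt i := i.elim0
  ctr_ge i _ := by simp [afterSize, single]

theorem emits_outputWord {L : FirstOrder.Language.{u, v}} {L' : FirstOrder.Language.{u', v'}}
    [Fintype (Σ k, L.Relations k)] [Fintype (Σ k, L'.Functions k)] [Fintype (Σ k, L'.Relations k)]
    (τ : TermMap L L') (A : Type w) [L.Structure A] [L'.Structure A] :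
    Emits (outputWord L' τ A) := by
  refine emits_size.append <| (emits_const [false]).append <| Emits.append
    (Emits.flatMap (W := fun (g : Σ k, L'.Functions k) n s => encodeRel (n := n) (outputFn τ g s)) _
      fun g => (polyTest_outputFn τ g).emit)
    (Emits.flatMap (W := fun (Q : Σ k, L'.Relations k) n s => encodeRel (n := n) (outputRl A Q s)) _
      fun Q => (polyTest_outputRl A Q).emit)

section Reduction

variable {L : FirstOrder.Language.{u, v}} {L' : FirstOrder.Language.{u', v'}}
  [Fintype (Σ k, L.Functions k)] [Fintype (Σ k, L.Relations k)]
  [Fintype (Σ k, L'.Functions k)] [Fintype (Σ k, L'.Relations k)]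

/-- The program of the reduction, from programs testing the validity of the input, generating the
congruence, and writing the output, and from the output for the empty structure. That case is
recognized by a pop of the size, which is undone afterwards. It is separate because the output
structure needs an element as the value of the dummy variables. -/
noncomputable def reduction (P₁ P₂ P₃ : Prog (Stk (Tab L))) (w₁ : List Bool) :
    Prog (Stk (Tab L)) :=
  .seq readSize <| (ifFlag · skip) <|
  .seq (readTables tabArity (tabList L)) <| (ifFlag · skip) <|
  .seq checkEmpty <| (ifFlag · skip) <|
  .seq P₁ <| (ifFlag · skip) <|
  .seq (.pop size fun _ x => (x.isSome, x)) <|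
  ifFlag (.seq (pushBit size true) (.seq P₂ P₃)) (emitConst w₁)

/-- If the structures have the same term operations and partial polymorphisms, then the constraint
satisfaction problem of the first reduces to that of the second. -/
theorem polyTimeReduces_CSP {A : Type w} [Finite A] [L.Structure A] [L'.Structure A]
    (hclone : clone L A = clone L' A)
    (hpartial : partialPolymorphisms L A = partialPolymorphisms L' A) :
    PolyTimeReduces (CSP L A) (CSP L' A) := by
  classical
  choose τ hτ using fun k (g : L'.Functions k) => exists_term_of_clone_eq hclone g
  choose τ' hτ' using fun k (f : L.Functions k) => exists_term_of_clone_eq hclone.symm f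
  obtain ⟨w₁, hw₁⟩ := exists_mem_CSP (L := L') A
  obtain ⟨P₁, p₁, hP₁⟩ := polyTest_valid (L := L) A
  obtain ⟨P₂, p₂, hP₂⟩ := (polyTest_closureTest τ τ' A).iterate Tab.cong 2
  obtain ⟨P₃, p₃, hP₃⟩ := emits_outputWord τ A
  let T : Polynomial ℕ := 3 * Polynomial.X + readTablesTime tabArity (tabList L) + p₁ + p₂ + p₃ +
    (w₁.length : Polynomial ℕ) + 12
  have main : ∀ x, ∃ b S, Does (reduction P₁ P₂ P₃ w₁) false (single inp x) b S
      (T.eval x.length) ∧ (x ∈ CSP L A ↔ S out ∈ CSP L' A) := by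
    intro x
    obtain ⟨n, l, rfl, hl⟩ := exists_eq_replicate_append x
    have hT : 3 * n + (readTablesTime tabArity (tabList L)).eval n + p₁.eval n + p₂.eval n +
        p₃.eval n + w₁.length + 12 ≤ T.eval (un n ++ l).length := by
      refine le_trans (le_of_eq ?_) (eval_mono T (m := n) (by simp))
      simp [T]
    generalize T.eval (un n ++ l).length = t at hT ⊢
    -- a computation that ends with an empty output is right if the input is no yes-instance
    have reject : ∀ {x : List Bool} {b S}, x ∉ CSP L A →
        Does (reduction P₁ P₂ P₃ w₁) false (single inp (un n ++ l)) b S t → S out = [] →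
        ∃ b S, Does (reduction P₁ P₂ P₃ w₁) false (single inp (un n ++ l)) b S t ∧
          (x ∈ CSP L A ↔ S out ∈ CSP L' A) := fun hx hd ho =>
      ⟨_, _, hd, by rw [ho]; exact iff_of_false hx nil_notMem_CSP⟩
    have h₁ := does_readSize (b := false) (S := single (inp : Stk (Tab L)) (un n ++ l)) n l hl
      (by simp [single])
    have e₁ : Function.update (Function.update (single (inp : Stk (Tab L)) (un n ++ l)) inp l.tail)
        size (un n ++ single (inp : Stk (Tab L)) (un n ++ l) size) = afterSize n l.tail := by
      simp [single, afterSize]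
    rw [e₁] at h₁
    rcases l with _ | ⟨b, l⟩
    · refine reject (fun h => ?_) (Does.of (h₁.seq (does_ifFlag_false does_skip)) rfl rfl ?_) ?_
      · simpa using false_mem_of_mem_CSP h
      · omega
      · simp [afterSize, single]
    obtain rfl : b = false := by simpa using hl
    simp only [List.head?_cons, Option.isSome_some, List.tail_cons] at h₁
    have hR := ready_afterSize (Arr := Tab L) n l
    have hit : afterSize (Arr := Tab L) n l iter = [] := by simp [afterSize, single]
    have hnew : afterSize (Arr := Tab L) n l new = [] := by simp [afterSize, single]
    have hout : afterSize (Arr := Tab L) n l out = [] := by simp [afterSize, single]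
    have harr : ∀ a, afterSize (Arr := Tab L) n l (arr a) = [] := fun a => by
      simp [afterSize, single]
    have hinp : afterSize (Arr := Tab L) n l inp = l := by simp [afterSize, single]
    -- yes-instances consist of tables of the right lengths
    have hmem : un n ++ false :: l ∈ CSP L A → ∃ X : L.Structure (Fin n),
        l = (tabList L).flatMap (tabOf X) := by
      rintro ⟨m, X, hX, -⟩
      rw [encode_eq] at hX
      obtain ⟨rfl, h⟩ := replicate_append_false_inj hX
      exact ⟨X, h.symm⟩
    by_cases hl₁ : ∃ (c : Tab L → List Bool) (l' : List Bool),
        (∀ a ∈ tabList L, (c a).length = n ^ tabArity a) ∧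
          afterSize (Arr := Tab L) n l inp = (tabList L).flatMap c ++ l'
    swap
    · obtain ⟨S', hS', h₂⟩ := does_readTables_fail nodup_tabList hR hit (fun a _ => harr a) hl₁
      refine reject (fun h => ?_) (Does.of (h₁.seq (does_ifFlag_true
        (h₂.seq (does_ifFlag_false does_skip)))) rfl rfl ?_) (hS'.trans hout)
      · obtain ⟨X, hX⟩ := hmem h
        exact hl₁ ⟨tabOf X, [], fun a ha => length_tabOf X ha, by rw [hinp, hX]; simp⟩
      · omega
    obtain ⟨c, l', hc, hcl⟩ := hl₁
    have h₂ := does_readTables nodup_tabList hR hit (fun a _ => harr a) c l' hc hcl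
    set s : Tab L → List Bool := fun a => if a ∈ tabList L then c a else afterSize n l (arr a)
      with hs
    set S₂ := withTables (Function.update (afterSize (Arr := Tab L) n l) inp l') s with hS₂
    have h₃ := does_checkEmpty (b := true) (S := S₂)
    have hS₂inp : S₂ inp = l' := by simp [S₂, withTables]
    rw [hS₂inp] at h₃
    rcases l' with _ | ⟨b, l'⟩
    swap
    · refine reject (fun h => ?_) (Does.of (h₁.seq (does_ifFlag_true (h₂.seq (does_ifFlag_true
        (h₃.seq (does_ifFlag_false does_skip)))))) rfl rfl ?_) ?_
      · obtain ⟨X, hX⟩ := hmem h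
        have h' := congrArg List.length hcl
        rw [hinp, hX, List.length_append, List.length_flatMap, List.length_flatMap,
          List.map_congr_left fun a ha => (length_tabOf X ha).trans (hc a ha).symm] at h'
        simp at h'
      · omega
      · simpa [S₂, withTables] using hout
    rw [List.append_nil, hinp] at hcl
    have e₃ : Function.update S₂ inp ([] : List Bool).tail = S₂ := by
      rw [Function.update_eq_self_iff, hS₂inp]; rfl
    rw [e₃] at h₃
    simp only [List.head?_nil, Option.isNone_none] at h₃
    have hR₂ : Ready n S₂ := Ready.withTables (hR.update_inp _) _
    have hout₂ : S₂ out = [] := by simpa [S₂, withTables] using hout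
    have hnew₂ : S₂ new = [] := by simpa [S₂, withTables] using hnew
    have hit₂ : S₂ iter = [] := by simpa [S₂, withTables] using hit
    have htab₂ : tables S₂ = s := by funext a; simp [tables, S₂, withTables]
    have hsc : ∀ a ∈ tabList L, s a = c a := fun a ha => by simp [hs, ha]
    have hscong : s Tab.cong = [] := by simp [hs, cong_notMem_tabList, harr]
    have h₄ := hP₁ n Fin.elim0 S₂ hR₂ true
    rw [htab₂] at h₄
    by_cases hv : Valid A n s
    swap
    · rw [decide_eq_false hv] at h₄
      refine reject (fun h => ?_) (Does.of (h₁.seq (does_ifFlag_true (h₂.seq (does_ifFlag_true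
        (h₃.seq (does_ifFlag_true (h₄.seq (does_ifFlag_false does_skip)))))))) rfl rfl ?_) hout₂
      · obtain ⟨X, hX⟩ := hmem h
        have hcX : ∀ a ∈ tabList L, c a = tabOf X a := flatMap_injective_of_length
          (fun a ha => (hc a ha).trans (length_tabOf X ha).symm) (hcl.symm.trans hX)
        have hrep : Represents X s := represents_of_eq_tabOf
          (fun f => (hsc _ (fn_mem_tabList f)).trans (hcX _ (fn_mem_tabList f)))
          fun R => (hsc _ (rl_mem_tabList R)).trans (hcX _ (rl_mem_tabList R))
        have he : un n ++ false :: l = encode L X := by rw [encode_eq, hX]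
        rw [he, encode_mem_CSP_iff] at h
        obtain ⟨φ⟩ := h
        exact hv ((valid_iff hrep).2 fun k R ⟨a, ha⟩ => ⟨φ ∘ a, Hom.map_rel φ R a ha⟩)
      · omega
    rw [decide_eq_true hv] at h₄
    obtain ⟨X, hX⟩ := exists_structure_of_valid
      (fun a ha => (congrArg List.length (hsc a ha)).trans (hc a ha)) hv
    have hrep : Represents X s := represents_of_eq_tabOf
      (fun f => hX _ (fn_mem_tabList f)) fun R => hX _ (rl_mem_tabList R)
    have he : un n ++ false :: l = encode L X := by
      rw [encode_eq, hcl, List.flatMap_congr fun a ha => (hsc a ha).symm.trans (hX a ha)]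
    have h₅ : Does (.pop size fun _ x => (x.isSome, x)) true S₂ (S₂ size).head?.isSome
        (Function.update S₂ size (S₂ size).tail) 1 :=
      fun o => ⟨_, 1, le_rfl, .pop size (fun _ x => (x.isSome, x)) (true, o) S₂⟩
    rw [hR₂.size] at h₅
    rcases n with _ | n
    · have e₅ : Function.update S₂ size (un 0).tail = S₂ := by
        rw [Function.update_eq_self_iff, hR₂.size]; rfl
      rw [e₅] at h₅
      have h₆ := does_emitConst (b := false) (S := S₂) w₁
      refine ⟨_, _, Does.of (h₁.seq (does_ifFlag_true (h₂.seq (does_ifFlag_true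
        (h₃.seq (does_ifFlag_true (h₄.seq (does_ifFlag_true (h₅.seq
          (does_ifFlag_false h₆)))))))))) rfl rfl ?_, ?_⟩
      · omega
      -- no relation of `A` forbids the homomorphism from the empty structure
      · rw [he, encode_mem_CSP_iff]
        exact iff_of_true (nonempty_hom_of_valid_zero hrep hv) (by simpa [hout₂] using hw₁)
    · have h₆ := does_pushBit (b := true)
        (S := Function.update S₂ size (un (n + 1)).tail) size true
      have e₆ : Function.update (Function.update S₂ size (un (n + 1)).tail) size
          (true :: Function.update S₂ size (un (n + 1)).tail size) = S₂ := by
        rw [Function.update_self, Function.update_idem, Function.update_eq_self_iff, hR₂.size]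
        rfl
      rw [e₆] at h₆
      have h₇ := hP₂ (n + 1) S₂ hR₂ hnew₂ hit₂
        (by
          have : S₂ (arr Tab.cong) = [] := hscong
          simp [this]) true
      rw [htab₂] at h₇
      change Does P₂ true S₂ true (withTables S₂ (closure τ τ' A (n + 1) s)) _ at h₇
      set S₃ := withTables S₂ (closure τ τ' A (n + 1) s) with hS₃
      have hR₃ : Ready (n + 1) S₃ := Ready.withTables hR₂ _
      have hout₃ : S₃ out = [] := by simpa [S₃, withTables] using hout₂
      have hnew₃ : S₃ new = [] := by simpa [S₃, withTables] using hnew₂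
      have htab₃ : tables S₃ = closure τ τ' A (n + 1) s := by
        funext a; simp [tables, S₃, withTables]
      have h₈ := hP₃ (n + 1) S₃ hR₃ hnew₃ true
      rw [htab₃, hout₃, List.append_nil] at h₈
      refine ⟨_, _, Does.of (h₁.seq (does_ifFlag_true (h₂.seq (does_ifFlag_true
        (h₃.seq (does_ifFlag_true (h₄.seq (does_ifFlag_true (h₅.seq
          (does_ifFlag_true (h₆.seq (h₇.seq h₈)))))))))))) rfl rfl ?_, ?_⟩
      · omega
      · rw [he, encode_mem_CSP_iff, Function.update_self]
        exact (outputWord_mem_CSP_iff L' hpartial hτ hτ' n.succ_pos hrep hscong hv).symm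
  choose b S hd hS using main
  exact ⟨fun x => S x out, computableInPolyTime_of_does _ _ T
    fun x => ⟨b x, S x, hd x, rfl⟩, hS⟩

end Reduction

end FinCSP

theorem mainTheorem4
    (L : FirstOrder.Language.{u, v}) (L' : FirstOrder.Language.{u', v'})
    [Fintype (Σ k, L.Functions k)] [Fintype (Σ k, L.Relations k)]
    [Fintype (Σ k, L'.Functions k)] [Fintype (Σ k, L'.Relations k)]
    (A : Type w) [Finite A] [L.Structure A] [L'.Structure A]
    (hclone : FinCSP.clone L A = FinCSP.clone L' A)
    (hpartial : FinCSP.partialPolymorphisms L A = FinCSP.partialPolymorphisms L' A) :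
    FinCSP.PolyTimeEquivalent (FinCSP.CSP L A) (FinCSP.CSP L' A) :=
  ⟨FinCSP.polyTimeReduces_CSP hclone hpartial, FinCSP.polyTimeReduces_CSP hclone.symm hpartial.symm⟩
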